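/- Let $S$ be a connected oriented surface of genus $g$ with $s\ge 1$ punctures and $2-2g-s<0$, presented as $S=\mathbb H/\Gamma$ with $\Gamma\cong\pi_1(S)$ a torsion-free subgroup of finite index in $SL_2(\mathbb Z)$ (every such $S$ is of this form up to homeomorphism); the lifts of the punctures are the points of $\mathbb P^1(\mathbb Q)$. For a field $K$, a $K$-point of the moduli space $\mathcal X=\mathcal X_{PGL_3,S}$ of framed $PGL_3$-local systems is a homomorphism $\rho:\Gamma\to PGL_3(K)$ together with a $\rho$-equivariant map from $\mathbb P^1(\mathbb Q)$ to the flags in $\mathbb P^2(K)$, up to conjugation. An ideal triangulation $T$ of $S$ is, after lifting to $\mathbb H$, a maximal $\Gamma$-invariant family of pairwise non-crossing geodesics with endpoints in $\mathbb P^1(\mathbb Q)$ that consists of finitely many $\Gamma$-orbits. Its canonical coordinates $X^T_i$ are: for every triangle of $T$, whose vertices in counterclockwise order carry flags $(A,a),(B,b),(C,c)$, the triple ratio $$\frac{f_a(B)f_b(C)f_c(A)}{f_a(C)f_b(A)f_c(B)},$$ where $f_a,f_b,f_c$ are equations of the lines $a,b,c$; and for every oriented edge $AC$, with adjacent triangles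 $ABC$ and $ACD$ ($A,B,C,D$ in counterclockwise order), the cross-ratio of the lines $a,AB,AC,AD$ through $A$, where the cross-ratio of $x_1,x_2,x_3,x_4$ is $\frac{(x_1-x_2)(x_3-x_4)}{(x_1-x_4)(x_2-x_3)}$. They are defined and non-zero at the framed local systems for which, at every triangle, the three flags are pairwise transversal and the points $A,B,C$ are not collinear; these form the domain of the coordinate system of $T$. A Laurent polynomial is positive integral if the coefficients of all its monomials are positive integers. A function on $\mathcal X$ is a good positive Laurent polynomial if for every $T$ it is equal, on the domain of the coordinate system of $T$, to a positive integral Laurent polynomial in the $X^T_i$. Let $\gamma\in\pi_1(S)$ be any loop. The trace of its monodromy $\rho(\gamma)\in PGL_3$ depends on the choice of a representative in $GL_3$, and the claim is the following. (a) For every ideal triangulation $T$ there are a Laurent monomial $\delta$ and non-zero positive integral Laurent polynomials $P_n$ ($n\ge 0$) in the canonical coordinates of $T$ such that, over every field $K$ and at every framed local system in the domain of the coordinate system of $T$, the monodromy $\rho(\gamma)$ has a representative $M\in GL_3(K)$ with $$\det M=\delta(X^T)\qquad\text{and}\qquad \operatorname{tr}(M^n)=P_n(X^T)\quad\text{for all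 } n\ge 0 .$$ (b) For every $n\ge 0$ the function $\operatorname{tr}(M^n)^3/\det(M^n)$ on $\mathcal X$, where $M$ is any representative of $\rho(\gamma)$ (the function does not depend on the choice, and it is the cube of the trace of the $n$-th power of a representative of determinant one), is a good positive Laurent polynomial. -/

import Mathlib

open scoped MatrixGroups LinearAlgebra.Projectivization

universe u

noncomputable section

namespace FockGoncharov

/-! ### Punctured surfaces and ideal triangulations

A punctured hyperbolic surface `S` is presented as `ℍ / Γ`, with `Γ` a torsion-free subgroup of
finite index in `SL(2, ℤ)` (which then meets the center `±1` trivially). Then `π₁(S) = Γ`, loops on `S` up to free homotopy are the conjugacy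
classes of `Γ`, the lifts of the punctures to the boundary of the universal cover `ℍ` are the
points of `ℙ¹(ℚ)`, and isotopy classes of ideal arcs on `S` are the `Γ`-orbits of geodesics in `ℍ`
joining two points of `ℙ¹(ℚ)`. Every oriented surface of genus `g` with `s ≥ 1` punctures and
`2 - 2g - s < 0` is of this form up to homeomorphism. -/

/-- The lifts of the punctures: the points of `ℙ¹(ℚ) = ℚ ∪ {∞}`. -/
abbrev Cusp : Type := OnePoint ℚ

/-- The action of `SL(2, ℤ)` on `ℙ¹(ℚ)` by Möbius transformations. -/
def deck (γ : SL(2, ℤ)) (c : Cusp) : Cusp :=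
  Matrix.SpecialLinearGroup.mapGL ℚ γ • c

/-- Homogeneous coordinates of a point of `ℙ¹(ℚ)`. -/
def homog (c : Cusp) : ℚ × ℚ :=
  c.elim (1, 0) (fun r => (r, 1))

/-- The bracket `x₁ y₂ - x₂ y₁` of the homogeneous coordinates of two points. -/
def bracket (a b : Cusp) : ℚ :=
  (homog a).1 * (homog b).2 - (homog a).2 * (homog b).1

/-- The sign of `orient a b c` does not depend on the choice of homogeneous coordinates. It is
positive if `a, b, c` are distinct and in counterclockwise order on the boundary circle of `ℍ`
(e.g. `0, 1, ∞`), negative if they are distinct and in clockwise order, and `0` otherwise. -/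
def orient (a b c : Cusp) : ℚ :=
  bracket a b * bracket b c * bracket c a

/-- The geodesics `ab` and `cd` cross: `c` and `d` lie on different sides of `ab`. -/
def Crosses (a b c d : Cusp) : Prop :=
  orient a b c * orient a b d < 0

/-- An (isotopy class of an) ideal triangulation of `S = ℍ / Γ`, given by its lift to `ℍ`:
a maximal `Γ`-invariant system of pairwise non-crossing geodesics with ends at cusps, which
consists of finitely many `Γ`-orbits. -/
structure IdealTriangulation (Γ : Subgroup SL(2, ℤ)) where
  /-- `Edge a b`: the geodesic from `a` to `b` is an edge. -/
  Edge : Cusp → Cusp → Prop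
  ne_of_edge : ∀ a b, Edge a b → a ≠ b
  symm : ∀ a b, Edge a b → Edge b a
  invariant : ∀ γ ∈ Γ, ∀ a b, Edge a b → Edge (deck γ a) (deck γ b)
  noncrossing : ∀ a b c d, Edge a b → Edge c d → ¬ Crosses a b c d
  maximal : ∀ a b, a ≠ b → (∀ c d, Edge c d → ¬ Crosses a b c d) → Edge a b
  finite_orbits : ∃ F : Set (Cusp × Cusp), F.Finite ∧
    ∀ a b, Edge a b → ∃ γ ∈ Γ, (deck γ a, deck γ b) ∈ F

namespace IdealTriangulation

variable {Γ : Subgroup SL(2, ℤ)} (T : IdealTriangulation Γ)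

/-- `a, b, c` are the vertices, in counterclockwise order, of a triangle of the lift of the
triangulation to `ℍ`. -/
def IsTriangle (a b c : Cusp) : Prop :=
  T.Edge a b ∧ T.Edge b c ∧ T.Edge c a ∧ 0 < orient a b c

/-- Marked points on `ℍ`: one for every triangle `abc`, and for every edge `ac`, with adjacent
triangles `abc` and `acd`, one close to `a` and one close to `c`. The constructor `edge` is
the marked point on `ac` close to `a`; the one close to `c` is `edge c d a b`. -/
inductive LiftedMark : Type
  | face (a b c : Cusp) (h : T.IsTriangle a b c) : LiftedMark
  | edge (a b c d : Cusp) (h₁ : T.IsTriangle a b c) (h₂ : T.IsTriangle a c d) : LiftedMark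

/-- Two descriptions of a marked point on `ℍ / Γ`: the vertices of a triangle may be rotated, and
deck transformations may be applied. -/
inductive MarkRel : T.LiftedMark → T.LiftedMark → Prop
  | rotate (a b c : Cusp) (h : T.IsTriangle a b c) (h' : T.IsTriangle b c a) :
      MarkRel (.face a b c h) (.face b c a h')
  | deckFace (γ : SL(2, ℤ)) (hγ : γ ∈ Γ) (a b c : Cusp) (h : T.IsTriangle a b c)
      (h' : T.IsTriangle (deck γ a) (deck γ b) (deck γ c)) :
      MarkRel (.face a b c h) (.face (deck γ a) (deck γ b) (deck γ c) h')
  | deckEdge (γ : SL(2, ℤ)) (hγ : γ ∈ Γ) (a b c d : Cusp)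
      (h₁ : T.IsTriangle a b c) (h₂ : T.IsTriangle a c d)
      (h₁' : T.IsTriangle (deck γ a) (deck γ b) (deck γ c))
      (h₂' : T.IsTriangle (deck γ a) (deck γ c) (deck γ d)) :
      MarkRel (.edge a b c d h₁ h₂)
        (.edge (deck γ a) (deck γ b) (deck γ c) (deck γ d) h₁' h₂')

/-- The marked points on `S`: one in every triangle and two on every edge. -/
def MarkedPoint : Type := Quot T.MarkRel

end IdealTriangulation

/-! ### Flags in the projective plane and their invariants -/

section Flags

variable {K : Type u} [Field K]

/-- A flag in the projective plane over `K`: a point `pt` and a line `ln` through it. A line is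
given by the class of the coefficients of its equation. -/
@[ext]
structure Flag (K : Type u) [Field K] where
  pt : ℙ K (Fin 3 → K)
  ln : ℙ K (Fin 3 → K)
  incident : pt.orthogonal ln

/-- The value of an equation of the line of `F` at a vector representing the point of `G`. -/
def pairing (F G : Flag K) : K := F.ln.rep ⬝ᵥ G.pt.rep

/-- The determinant of vectors representing the points of three flags. -/
def det3 (F G H : Flag K) : K := (Matrix.of ![F.pt.rep, G.pt.rep, H.pt.rep]).det

/-- The triple ratio of three flags `(A, a)`, `(B, b)`, `(C, c)`:
`f_a(B) f_b(C) f_c(A) / (f_a(C) f_b(A) f_c(B))`. -/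
def tripleRatio (F G H : Flag K) : K :=
  (pairing F G * pairing G H * pairing H F) / (pairing F H * pairing G F * pairing H G)

/-- The cross-ratio of the lines `a, AB, AC, AD` through `A`, for flags `(A, a)`, `(B, b)`,
`(C, c)`, `(D, d)`: the value at `AD` of the projective coordinate on the pencil of lines through
`A` which is `∞` at `a`, `-1` at `AB` and `0` at `AC`. (The function `det(A, C, P) / f_a(P)` of the
line `AP` is a projective coordinate which is `∞` at `a` and `0` at `AC`.) -/
def edgeRatio (F G H J : Flag K) : K :=
  (pairing F G * det3 F H J) / (pairing F J * det3 F G H)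

end Flags

/-! ### The moduli space of framed `PGL₃`-local systems -/

/-- A `K`-point of the moduli space of framed `PGL₃`-local systems on `S = ℍ / Γ`: a monodromy
representation `ρ` of `π₁(S) = Γ` in `PGL₃(K)` and a `ρ`-equivariant map `β` from the lifts of the
punctures to flags (equivalently, a flat section of the associated flag bundle around each
puncture). Points of the moduli space are such pairs up to conjugation by `PGL₃`. -/
structure FramedLocalSystem (Γ : Subgroup SL(2, ℤ)) (K : Type u) [Field K] where
  ρ : Γ →* PGL(3, K)
  β : Cusp → Flag K
  pt_deck : ∀ (γ : Γ) (c : Cusp), (β (deck γ c)).pt = ρ γ • (β c).pt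
  ln_deck : ∀ (γ : Γ) (c : Cusp) (p : ℙ K (Fin 3 → K)),
    (ρ γ • p).orthogonal (β (deck γ c)).ln ↔ p.orthogonal (β c).ln

namespace FramedLocalSystem

variable {Γ : Subgroup SL(2, ℤ)} {K : Type u} [Field K]

/-- Deck transformations change the vectors and the equations representing the flags by a matrix
and by scalars. -/
theorem exists_scalars (L : FramedLocalSystem Γ K) (γ : Γ) :
    ∃ (g : GL (Fin 3) K) (s t : Cusp → K), (∀ c, s c ≠ 0) ∧ (∀ c, t c ≠ 0) ∧
      (∀ c, (L.β (deck γ c)).pt.rep = s c • (g.1.mulVec (L.β c).pt.rep)) ∧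
      (∀ c v, (L.β (deck γ c)).ln.rep ⬝ᵥ (g.1.mulVec v) = t c * ((L.β c).ln.rep ⬝ᵥ v)) := by
  obtain ⟨g, hg⟩ := Matrix.ProjGenLinGroup.mk_surjective (L.ρ γ)
  have hpt : ∀ c, ∃ s : K, s ≠ 0 ∧
      (L.β (deck γ c)).pt.rep = s • (g.1.mulVec (L.β c).pt.rep) := by
    intro c
    have hne : g • (L.β c).pt.rep ≠ 0 := (smul_ne_zero_iff_ne g).2 (L.β c).pt.rep_nonzero
    have h : (L.β (deck γ c)).pt = Projectivization.mk K (g • (L.β c).pt.rep) hne := by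
      rw [L.pt_deck γ c, ← hg]
      conv_lhs => rw [← (L.β c).pt.mk_rep]
      exact Projectivization.PGL.mk_smul_mk g _
    obtain ⟨a, ha⟩ := Projectivization.exists_smul_eq_mk_rep K _ hne
    exact ⟨a, a.ne_zero, by rw [h, ← ha]; rfl⟩
  have hln : ∀ c, ∃ t : K, t ≠ 0 ∧
      ∀ v, (L.β (deck γ c)).ln.rep ⬝ᵥ (g.1.mulVec v) = t * ((L.β c).ln.rep ⬝ᵥ v) := by
    intro c
    have key : ∀ v : Fin 3 → K,
        (L.β (deck γ c)).ln.rep ⬝ᵥ (g.1.mulVec v) = 0 ↔ (L.β c).ln.rep ⬝ᵥ v = 0 := by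
      intro v
      by_cases hv : v = 0
      · simp [hv]
      have hne : g • v ≠ 0 := (smul_ne_zero_iff_ne g).2 hv
      have h := L.ln_deck γ c (Projectivization.mk K v hv)
      rw [← hg, Projectivization.PGL.mk_smul_mk g hv, ← (L.β (deck γ c)).ln.mk_rep,
        ← (L.β c).ln.mk_rep, Projectivization.orthogonal_mk, Projectivization.orthogonal_mk] at h
      rw [dotProduct_comm, dotProduct_comm _ v]
      exact h
    obtain ⟨w, hw⟩ : ∃ w, (L.β c).ln.rep ⬝ᵥ w ≠ 0 := by
      by_contra hcon
      push Not at hcon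
      exact (L.β c).ln.rep_nonzero (dotProduct_eq_zero_iff.1 hcon)
    refine ⟨((L.β (deck γ c)).ln.rep ⬝ᵥ (g.1.mulVec w)) / ((L.β c).ln.rep ⬝ᵥ w),
      div_ne_zero (fun h => hw ((key w).1 h)) hw, fun v => ?_⟩
    have h := (key (v - (((L.β c).ln.rep ⬝ᵥ v) / ((L.β c).ln.rep ⬝ᵥ w)) • w)).2 (by
      rw [dotProduct_sub, dotProduct_smul, smul_eq_mul, div_mul_cancel₀ _ hw, sub_self])
    rw [Matrix.mulVec_sub, Matrix.mulVec_smul, dotProduct_sub, dotProduct_smul, smul_eq_mul,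
      sub_eq_zero] at h
    rw [h]
    ring
  choose s hs hs' using hpt
  choose t ht ht' using hln
  exact ⟨g, s, t, hs, ht, hs', ht'⟩

/-- The coordinate at a marked point of `ℍ`. -/
def liftedCoord (L : FramedLocalSystem Γ K) (T : IdealTriangulation Γ) : T.LiftedMark → K
  | .face a b c _ => tripleRatio (L.β a) (L.β b) (L.β c)
  | .edge a b c d _ _ => edgeRatio (L.β a) (L.β b) (L.β c) (L.β d)

theorem liftedCoord_eq (L : FramedLocalSystem Γ K) (T : IdealTriangulation Γ)
    (x y : T.LiftedMark) (h : T.MarkRel x y) : L.liftedCoord T x = L.liftedCoord T y := by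
  cases h with
  | rotate a b c h h' =>
    simp only [liftedCoord, tripleRatio]
    congr 1 <;> ring
  | deckFace γ hγ a b c h h' =>
    obtain ⟨g, s, t, hs, ht, hp, hl⟩ := L.exists_scalars ⟨γ, hγ⟩
    have hpair : ∀ a b, pairing (L.β (deck γ a)) (L.β (deck γ b)) =
        t a * s b * pairing (L.β a) (L.β b) := by
      intro a b
      simp only [pairing]
      rw [hp b, dotProduct_smul, hl a, smul_eq_mul]
      ring
    simp only [liftedCoord, tripleRatio, hpair]
    have h1 := hs a
    have h2 := hs b
    have h3 := hs c
    have h4 := ht a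
    have h5 := ht b
    have h6 := ht c
    rw [← mul_div_mul_left _ _ (mul_ne_zero (mul_ne_zero (mul_ne_zero h1 h2) h3)
      (mul_ne_zero (mul_ne_zero h4 h5) h6))]
    congr 1 <;> ring
  | deckEdge γ hγ a b c d h₁ h₂ h₁' h₂' =>
    obtain ⟨g, s, t, hs, ht, hp, hl⟩ := L.exists_scalars ⟨γ, hγ⟩
    have hpair : ∀ a b, pairing (L.β (deck γ a)) (L.β (deck γ b)) =
        t a * s b * pairing (L.β a) (L.β b) := by
      intro a b
      simp only [pairing]
      rw [hp b, dotProduct_smul, hl a, smul_eq_mul]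
      ring
    have hdet : ∀ a b c, det3 (L.β (deck γ a)) (L.β (deck γ b)) (L.β (deck γ c)) =
        s a * s b * s c * g.1.det * det3 (L.β a) (L.β b) (L.β c) := by
      intro a b c
      simp only [det3]
      rw [hp a, hp b, hp c]
      simp only [Matrix.det_fin_three, Matrix.mulVec, dotProduct, Fin.sum_univ_three,
        Pi.smul_apply, smul_eq_mul, Matrix.of_apply, Matrix.cons_val_zero, Matrix.cons_val_one,
        Matrix.cons_val]
      ring
    have hg : g.1.det ≠ 0 := g.det_ne_zero
    simp only [liftedCoord, edgeRatio, hpair, hdet]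
    rw [← mul_div_mul_left _ _ (mul_ne_zero (mul_ne_zero (mul_ne_zero (mul_ne_zero (ht a) (hs a))
      (mul_ne_zero (hs b) (hs c))) (hs d)) hg)]
    congr 1 <;> ring

/-- The canonical coordinates `X_i^T` assigned to an ideal triangulation `T`. -/
def coord (L : FramedLocalSystem Γ K) (T : IdealTriangulation Γ) : T.MarkedPoint → K :=
  Quot.lift (L.liftedCoord T) (L.liftedCoord_eq T)

/-- The domain of the canonical coordinate system of `T`, i.e. the locus where all coordinates are
defined and non-zero: at every triangle, the three flags are pairwise transversal and the three
points are not collinear. -/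
def InChart (L : FramedLocalSystem Γ K) (T : IdealTriangulation Γ) : Prop :=
  ∀ a b c, T.IsTriangle a b c →
    pairing (L.β a) (L.β b) ≠ 0 ∧ pairing (L.β b) (L.β a) ≠ 0 ∧
      det3 (L.β a) (L.β b) (L.β c) ≠ 0

end FramedLocalSystem

/-! ### Laurent polynomials -/

/-- Laurent polynomials with integer coefficients in variables indexed by `ι`. -/
abbrev Laurent (ι : Type) : Type := AddMonoidAlgebra ℤ (ι →₀ ℤ)

/-- The value of the Laurent monomial with exponents `m` at `x`. -/
def monomialEval {ι : Type} {K : Type u} [Field K] (m : ι →₀ ℤ) (x : ι → K) : K :=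
  m.prod fun i k => x i ^ k

namespace Laurent

/-- The value of a Laurent polynomial at a point with non-zero coordinates. -/
def eval {ι : Type} {K : Type u} [Field K] (P : Laurent ι) (x : ι → K) : K :=
  P.coeff.sum fun m k => (k : K) * monomialEval m x

/-- All coefficients (of the monomials that occur) are positive integers. -/
def IsPositiveIntegral {ι : Type} (P : Laurent ι) : Prop :=
  ∀ m ∈ P.coeff.support, 0 < P.coeff m

end Laurent

/-- A function on the moduli space is a good positive Laurent polynomial if it is a positive
integral Laurent polynomial in every canonical coordinate system. -/
def IsGoodPositiveLaurent (Γ : Subgroup SL(2, ℤ))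
    (f : ∀ (K : Type u) [Field K], FramedLocalSystem Γ K → K) : Prop :=
  ∀ T : IdealTriangulation Γ, ∃ P : Laurent T.MarkedPoint, P.IsPositiveIntegral ∧
    ∀ (K : Type u) [Field K] (L : FramedLocalSystem Γ K), L.InChart T →
      f K L = P.eval (L.coord T)

/-- The function `tr(M)³ / det(M)` of the class of `M` in `PGL₃(K)`. It is the cube of the trace of
a representative of determinant one. -/
def traceCube {K : Type u} [Field K] (p : PGL(3, K)) : K :=
  (Function.surjInv Matrix.ProjGenLinGroup.mk_surjective p).1.trace ^ 3 /
    (Function.surjInv Matrix.ProjGenLinGroup.mk_surjective p).1.det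

theorem traceCube_mk {K : Type u} [Field K] (M : GL (Fin 3) K) :
    traceCube (Matrix.ProjGenLinGroup.mk M) = M.1.trace ^ 3 / M.1.det := by
  set N := Function.surjInv Matrix.ProjGenLinGroup.mk_surjective (Matrix.ProjGenLinGroup.mk M)
    with hN
  have h : Matrix.ProjGenLinGroup.mk N = Matrix.ProjGenLinGroup.mk M :=
    Function.surjInv_eq Matrix.ProjGenLinGroup.mk_surjective _
  obtain ⟨u, hu⟩ := Matrix.ProjGenLinGroup.mk_eq_mk_iff.1 h
  have hM : M.1 = (u : K) • N.1 := by
    rw [← hu]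
    ext i j
    simp [Matrix.GeneralLinearGroup.scalar, mul_comm]
  have hu0 : (u : K) ^ 3 ≠ 0 := pow_ne_zero _ u.ne_zero
  unfold traceCube
  rw [← hN, hM, Matrix.trace_smul, Matrix.det_smul, smul_eq_mul, mul_pow, Fintype.card_fin,
    mul_div_mul_left _ _ hu0]

end FockGoncharov

end

noncomputable section

namespace FockGoncharov

/-! ### The cyclic order on cusps -/

/-! To every oriented edge of the lifted triangulation belongs a projective coordinate system on
`K³` (`frame`), built from the flags at its ends and normalized at the third vertex of the triangle
on its left. Crossing this triangle and leaving through another side changes the frame, up to a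
scalar, by a triangular matrix (`flagFrame_rightTurn`, `flagFrame_leftTurn`). Its entries are
polynomials with natural coefficients in Laurent monomials, and its diagonal entries and determinant
are monomials. A walk of such turns multiplies these matrices, and no subtraction ever occurs.

Frames are equivariant up to scalars (`exists_frame_act_mul`). Hence the matrix of a walk from an
edge to its translate by `γ⁻¹` is conjugate to a representative of `ρ γ` (`exists_representative`).
This gives the monomial determinant and the positive traces in (a); (b) follows because dividing by
the determinant is multiplication by a monomial.

What remains is combinatorial: some edge must be joined to its translate by a walk. Walks between
nested edges exist because every edge bounds a triangle on each side (`exists_isTriangle`) and a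
geodesic crosses only finitely many edges (`finite_crossing`). If the walk arrives with the wrong
orientation, it is shortened from both ends (`exists_walk_of_facing`); the shortest cases would make
`γ` of order 2 or 3, so torsion-freeness leaves `γ = 1`.

Coefficients in `ℕ` make positivity automatic, and their sum (`coeffSum`) detects non-vanishing
independently of the field. -/

/-- An order preserving map from `ℚ ∪ {∞}`, with `∞` as largest element, to `[-1, 1]`. -/
def cuspKey (c : Cusp) : ℚ := c.elim 1 fun r => r / (1 + |r|)

theorem cuspKey_infty : cuspKey OnePoint.infty = 1 := rfl

theorem cuspKey_coe (r : ℚ) : cuspKey (r : Cusp) = r / (1 + |r|) := rfl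

theorem cuspKey_coe_strictMono : StrictMono fun r : ℚ => cuspKey (r : Cusp) := by
  intro r s h
  simp only [cuspKey_coe]
  rw [div_lt_div_iff₀ (by positivity) (by positivity)]
  rcases abs_cases r with ⟨h1, h2⟩ | ⟨h1, h2⟩ <;> rcases abs_cases s with ⟨h3, h4⟩ | ⟨h3, h4⟩ <;>
    rw [h1, h3] <;> nlinarith

theorem cuspKey_coe_lt_one (r : ℚ) : cuspKey (r : Cusp) < 1 := by
  rw [cuspKey_coe, div_lt_one (by positivity)]
  linarith [le_abs_self r]

theorem cuspKey_le_one (c : Cusp) : cuspKey c ≤ 1 := by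
  induction c using OnePoint.rec with
  | infty => exact le_refl 1
  | coe r => exact (cuspKey_coe_lt_one r).le

theorem neg_one_le_cuspKey (c : Cusp) : -1 ≤ cuspKey c := by
  induction c using OnePoint.rec with
  | infty => rw [cuspKey_infty]; norm_num
  | coe r =>
    rw [cuspKey_coe, le_div_iff₀ (by positivity)]
    linarith [neg_abs_le r]

theorem cuspKey_injective : Function.Injective cuspKey := by
  intro a b h
  induction a using OnePoint.rec with
  | infty =>
    induction b using OnePoint.rec with
    | infty => rfl
    | coe s => exact absurd h (cuspKey_coe_lt_one s).ne'
  | coe r =>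
    induction b using OnePoint.rec with
    | infty => exact absurd h (cuspKey_coe_lt_one r).ne
    | coe s => rw [cuspKey_coe_strictMono.injective h]

theorem cyclic_product_pos_iff (r s t : ℚ) : 0 < (r - s) * (s - t) * (t - r) ↔
    (r < s ∧ s < t) ∨ (s < t ∧ t < r) ∨ (t < r ∧ r < s) := by
  constructor
  · intro h
    by_contra hc
    simp only [not_or, not_and, not_lt] at hc
    obtain ⟨h1, h2, h3⟩ := hc
    rcases lt_or_ge r s with ha | ha
    · have hb := h1 ha
      rcases lt_or_ge t r with hd | hd
      · linarith [h3 hd]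
      · nlinarith [mul_nonneg (mul_nonneg (sub_nonneg.2 ha.le) (sub_nonneg.2 hb)) (sub_nonneg.2 hd)]
    · rcases lt_or_ge s t with hb | hb
      · have := h2 hb
        nlinarith [mul_nonneg (mul_nonneg (sub_nonneg.2 ha) (sub_nonneg.2 hb.le))
          (sub_nonneg.2 this)]
      · nlinarith [mul_nonneg (mul_nonneg (sub_nonneg.2 ha) (sub_nonneg.2 hb))
          (sub_nonneg.2 (hb.trans ha))]
  · rintro (⟨h1, h2⟩ | ⟨h1, h2⟩ | ⟨h1, h2⟩)
    · nlinarith [mul_pos (mul_pos (sub_pos.2 h1) (sub_pos.2 h2)) (sub_pos.2 (h1.trans h2))]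
    · nlinarith [mul_pos (mul_pos (sub_pos.2 h1) (sub_pos.2 h2)) (sub_pos.2 (h1.trans h2))]
    · nlinarith [mul_pos (mul_pos (sub_pos.2 h1) (sub_pos.2 h2)) (sub_pos.2 (h1.trans h2))]

/-- The triple `a, b, c` is cyclically ordered by `κ`. -/
def IsCyc (κ : Cusp → ℚ) (a b c : Cusp) : Prop :=
  (κ a < κ b ∧ κ b < κ c) ∨ (κ b < κ c ∧ κ c < κ a) ∨ (κ c < κ a ∧ κ a < κ b)

theorem orient_pos_iff_cuspKey (a b c : Cusp) : 0 < orient a b c ↔ IsCyc cuspKey a b c := by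
  have hm : ∀ r s : ℚ, cuspKey (r : Cusp) < cuspKey (s : Cusp) ↔ r < s :=
    fun r s => cuspKey_coe_strictMono.lt_iff_lt
  have hi : ∀ r : ℚ, ¬ 1 < cuspKey (r : Cusp) := fun r => (cuspKey_coe_lt_one r).not_gt
  induction a using OnePoint.rec <;> induction b using OnePoint.rec <;>
    induction c using OnePoint.rec <;>
    simp [IsCyc, orient, bracket, homog, cuspKey_infty, hm, hi, cuspKey_coe_lt_one,
      OnePoint.elim_infty, OnePoint.elim_some, cyclic_product_pos_iff]

/-- The circle of cusps can be cut at any cusp `p`, which becomes the largest element. -/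
theorem exists_cut (p : Cusp) : ∃ κ : Cusp → ℚ, Function.Injective κ ∧ (∀ x, κ x ≤ κ p) ∧
    ∀ a b c, 0 < orient a b c ↔ IsCyc κ a b c := by
  have h1 := cuspKey_le_one
  have h2 := neg_one_le_cuspKey
  -- Rotating the linear order does not affect the cyclic one: the keys up to that of `p` are moved
  -- above all others. Keys lie in `[-1, 1]`, so any shift larger than 2 would do.
  refine ⟨fun x => if cuspKey x ≤ cuspKey p then cuspKey x + 10 else cuspKey x, ?_, ?_, ?_⟩
  · intro x y h
    apply cuspKey_injective
    dsimp only at h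
    have := h1 x; have := h1 y; have := h2 x; have := h2 y
    split_ifs at h <;> linarith
  · intro x
    dsimp only
    have := h1 x; have := h2 p
    simp only [le_refl, if_true]
    split_ifs <;> linarith
  · intro a b c
    rw [orient_pos_iff_cuspKey]
    have := h1 a; have := h1 b; have := h1 c; have := h2 a; have := h2 b; have := h2 c
    simp only [IsCyc]
    split_ifs <;> grind

theorem orient_swap (a b c : Cusp) : orient b a c = - orient a b c := by
  simp only [orient, bracket]; ring

/-- Only positivity of `orient` is visible in a cut circle, so the negative sign is traded for a
swap of `a` and `b`. Crossing then becomes a question about a linear order. -/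
theorem crosses_iff (a b c d : Cusp) : Crosses a b c d ↔
    (0 < orient a b c ∧ 0 < orient b a d) ∨ (0 < orient b a c ∧ 0 < orient a b d) := by
  rw [orient_swap a b c, orient_swap a b d, Crosses, mul_neg_iff]
  constructor <;> rintro (⟨h, h'⟩ | ⟨h, h'⟩) <;> simp_all

theorem orient_rotate (a b c : Cusp) : orient b c a = orient a b c := by
  simp only [orient]; ring

/-! ### Primitive integer vectors -/

/-- The primitive integer vector representing a cusp. -/
def vec (c : Cusp) : ℤ × ℤ := c.elim (1, 0) fun r => (r.num, r.den)

/-- The determinant of the primitive vectors of two cusps. -/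
def delta (a b : Cusp) : ℤ := (vec a).1 * (vec b).2 - (vec a).2 * (vec b).1

theorem vec_eq_homog (c : Cusp) : ∃ w : ℚ, 0 < w ∧
    ((vec c).1 : ℚ) = w * (homog c).1 ∧ ((vec c).2 : ℚ) = w * (homog c).2 := by
  induction c using OnePoint.rec with
  | infty => exact ⟨1, by simp [vec, homog]⟩
  | coe r => exact ⟨r.den, by simp [vec, homog, r.den_pos, Rat.den_mul_eq_num]⟩

theorem isCoprime_vec (c : Cusp) : IsCoprime (vec c).1 (vec c).2 := by
  induction c using OnePoint.rec with
  | infty => exact isCoprime_one_left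
  | coe r => simpa [vec] using Rat.isCoprime_num_den r

theorem delta_swap (a b : Cusp) : delta b a = - delta a b := by
  simp only [delta]; ring

theorem delta_plucker (a b c d : Cusp) :
    delta a b * delta c d = delta a c * delta b d - delta a d * delta b c := by
  simp only [delta]; ring

theorem orient_pos_iff_delta (a b c : Cusp) :
    0 < orient a b c ↔ 0 < delta a b * delta b c * delta c a := by
  obtain ⟨u, hu, hu1, hu2⟩ := vec_eq_homog a
  obtain ⟨v, hv, hv1, hv2⟩ := vec_eq_homog b
  obtain ⟨w, hw, hw1, hw2⟩ := vec_eq_homog c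
  have h : ((delta a b * delta b c * delta c a : ℤ) : ℚ) = (u * v * w) ^ 2 * orient a b c := by
    simp only [delta, orient, bracket]
    push_cast
    rw [hu1, hu2, hv1, hv2, hw1, hw2]
    ring
  rw [← Int.cast_pos (R := ℚ), h]
  exact (mul_pos_iff_of_pos_left (by positivity)).symm

/-- The factor is the Bézout functional of one vector evaluated at the other; exchanging the two
vectors gives its inverse in `ℤ`, so it is a sign. -/
theorem IsCoprime.eq_unit_smul {p q p' q' : ℤ} (h : IsCoprime p q) (h' : IsCoprime p' q')
    (hd : p * q' = q * p') : ∃ ε : ℤ, ε * ε = 1 ∧ p = ε * p' ∧ q = ε * q' := by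
  obtain ⟨x, y, hxy⟩ := h
  obtain ⟨x', y', hxy'⟩ := h'
  have h1 : p = (p * x' + q * y') * p' := by
    linear_combination (-p) * hxy' + y' * hd
  have h2 : q = (p * x' + q * y') * q' := by
    linear_combination (-q) * hxy' - x' * hd
  have h3 : p' = (p' * x + q' * y) * p := by
    linear_combination (-p') * hxy - y * hd
  have h4 : q' = (p' * x + q' * y) * q := by
    linear_combination (-q') * hxy + x * hd
  have h5 : (p * x' + q * y') * (p' * x + q' * y) = 1 := by
    linear_combination hxy - x * h1 - y * h2
  refine ⟨p * x' + q * y', ?_, h1, h2⟩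
  rcases Int.isUnit_iff.1 (IsUnit.of_mul_eq_one _ h5) with h | h <;> rw [h] <;> rfl

theorem vec_injective : Function.Injective vec := by
  intro a b h
  induction a using OnePoint.rec with
  | infty =>
    induction b using OnePoint.rec with
    | infty => rfl
    | coe s =>
      simp [vec] at h
      exact absurd h.2.symm (by exact_mod_cast s.den_nz)
  | coe r =>
    induction b using OnePoint.rec with
    | infty => simp [vec] at h
    | coe s =>
      simp [vec] at h
      rw [Rat.ext h.1 h.2]

theorem delta_eq_zero_iff (a b : Cusp) : delta a b = 0 ↔ a = b := by
  constructor
  · intro h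
    obtain ⟨ε, hε, h1, h2⟩ := IsCoprime.eq_unit_smul (isCoprime_vec a) (isCoprime_vec b)
      (sub_eq_zero.1 h)
    -- The normalization of `vec` excludes the sign `-1`.
    have hnn : ∀ c, 0 < (vec c).2 ∨ ((vec c).1 = 1 ∧ (vec c).2 = 0) := by
      intro c
      induction c using OnePoint.rec with
      | infty => simp [vec]
      | coe r => simp [vec, r.den_pos]
    apply vec_injective
    rcases Int.isUnit_iff.1 (IsUnit.of_mul_eq_one _ hε) with h | h
    · exact Prod.ext (by rw [h1, h, one_mul]) (by rw [h2, h, one_mul])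
    · subst h
      have := hnn a
      have := hnn b
      omega
  · rintro rfl
    simp only [delta]; ring

theorem abs_delta_pos {a b : Cusp} (h : a ≠ b) : 0 < |delta a b| :=
  abs_pos.2 fun h' => h ((delta_eq_zero_iff a b).1 h')

/-- There are finitely many cusps at bounded distance from two given ones. -/
theorem finite_of_delta_le {p q : Cusp} (h : p ≠ q) (B : ℤ) :
    {c : Cusp | |delta p c| ≤ B ∧ |delta q c| ≤ B}.Finite := by
  refine Set.Finite.of_injOn (f := fun c => (delta p c, delta q c))
    (t := Set.Icc (-B) B ×ˢ Set.Icc (-B) B) ?_ ?_ ((Set.finite_Icc _ _).prod (Set.finite_Icc _ _))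
  · intro c hc
    exact ⟨abs_le.1 hc.1, abs_le.1 hc.2⟩
  · intro c _ c' _ hcc
    simp only [Prod.mk.injEq] at hcc
    -- If `c` and `c'` have the same two values, the right side of the Plücker relation vanishes.
    have := delta_plucker p q c c'
    rw [hcc.1, hcc.2, sub_self] at this
    rcases mul_eq_zero.1 this with h0 | h0
    · exact absurd ((delta_eq_zero_iff p q).1 h0) h
    · exact (delta_eq_zero_iff c c').1 h0

/-! ### Deck transformations -/

theorem deck_mul (γ δ : SL(2, ℤ)) (c : Cusp) : deck (γ * δ) c = deck γ (deck δ c) := by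
  simp only [deck, map_mul, mul_smul]

theorem deck_one (c : Cusp) : deck 1 c = c := by
  simp only [deck, map_one, one_smul]

theorem vec_deck (γ : SL(2, ℤ)) (c : Cusp) : ∃ ε : ℤ, ε * ε = 1 ∧
    (vec (deck γ c)).1 = ε * (γ 0 0 * (vec c).1 + γ 0 1 * (vec c).2) ∧
    (vec (deck γ c)).2 = ε * (γ 1 0 * (vec c).1 + γ 1 1 * (vec c).2) := by
  have hdet : γ 0 0 * γ 1 1 - γ 0 1 * γ 1 0 = 1 := by
    rw [← Matrix.det_fin_two]; exact γ.2
  refine IsCoprime.eq_unit_smul (isCoprime_vec _) ?_ ?_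
  · obtain ⟨x, y, h⟩ := isCoprime_vec c
    refine ⟨x * γ 1 1 - y * γ 1 0, - x * γ 0 1 + y * γ 0 0, ?_⟩
    linear_combination h + (x * (vec c).1 + y * (vec c).2) * hdet
  · obtain ⟨w, hw, hw1, hw2⟩ := vec_eq_homog (deck γ c)
    obtain ⟨u, hu, hu1, hu2⟩ := vec_eq_homog c
    have : (homog (deck γ c)).1 * (γ 1 0 * (homog c).1 + γ 1 1 * (homog c).2) =
        (homog (deck γ c)).2 * (γ 0 0 * (homog c).1 + γ 0 1 * (homog c).2) := by
      induction c using OnePoint.rec with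
      | infty =>
        rw [deck, OnePoint.smul_infty_eq_ite]
        split_ifs with h
        · simp at h
          simp [homog, h]
        · simp at h
          simp [homog, h]
      | coe r =>
        rw [deck, OnePoint.smul_some_eq_ite]
        split_ifs with h
        · simp at h
          simp [homog, h]
        · simp at h
          simp [homog]
          rw [div_mul_cancel₀ _ h]
    have h2 : (((vec (deck γ c)).1 * (γ 1 0 * (vec c).1 + γ 1 1 * (vec c).2) : ℤ) : ℚ) =
        ((vec (deck γ c)).2 * (γ 0 0 * (vec c).1 + γ 0 1 * (vec c).2) : ℤ) := by
      push_cast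
      rw [hw1, hw2, hu1, hu2]
      linear_combination w * u * this
    exact_mod_cast h2

theorem delta_deck (γ : SL(2, ℤ)) : ∃ ε : Cusp → ℤ, (∀ c, ε c * ε c = 1) ∧
    ∀ a b, delta (deck γ a) (deck γ b) = ε a * ε b * delta a b := by
  have hdet : γ 0 0 * γ 1 1 - γ 0 1 * γ 1 0 = 1 := by
    rw [← Matrix.det_fin_two]; exact γ.2
  choose ε h1 h2 h3 using vec_deck γ
  refine ⟨ε, h1, fun a b => ?_⟩
  simp only [delta]
  rw [h2, h3, h2, h3]
  linear_combination ε a * ε b * ((vec a).1 * (vec b).2 - (vec a).2 * (vec b).1) * hdet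

theorem abs_delta_deck (γ : SL(2, ℤ)) (a b : Cusp) :
    |delta (deck γ a) (deck γ b)| = |delta a b| := by
  obtain ⟨ε, h1, h2⟩ := delta_deck γ
  have h : ∀ c, |ε c| = 1 := fun c => Int.isUnit_iff_abs_eq.1 (IsUnit.of_mul_eq_one _ (h1 c))
  rw [h2, abs_mul, abs_mul, h, h, one_mul, one_mul]

theorem orient_deck_pos_iff (γ : SL(2, ℤ)) (a b c : Cusp) :
    0 < orient (deck γ a) (deck γ b) (deck γ c) ↔ 0 < orient a b c := by
  obtain ⟨ε, h1, h2⟩ := delta_deck γ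
  rw [orient_pos_iff_delta, orient_pos_iff_delta, h2, h2, h2]
  have : ε a * ε b * delta a b * (ε b * ε c * delta b c) * (ε c * ε a * delta c a) =
      (ε a * ε a) * (ε b * ε b) * (ε c * ε c) * (delta a b * delta b c * delta c a) := by ring
  rw [this, h1, h1, h1, one_mul, one_mul, one_mul]

/-- The parabolic transformation `v ↦ v + k det(u, v) u`, where `u` represents `a`. -/
def parabolic (a : Cusp) (k : ℤ) : SL(2, ℤ) :=
  ⟨!![1 - k * ((vec a).1 * (vec a).2), k * ((vec a).1 * (vec a).1);
      - (k * ((vec a).2 * (vec a).2)), 1 + k * ((vec a).1 * (vec a).2)], by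
    rw [Matrix.det_fin_two_of]; ring⟩

theorem parabolic_pow (a : Cusp) (n : ℕ) : parabolic a 1 ^ n = parabolic a n := by
  induction n with
  | zero =>
    rw [pow_zero]
    ext i j
    fin_cases i <;> fin_cases j <;> simp [parabolic]
  | succ n ih =>
    rw [pow_succ, ih]
    ext i j
    rw [Matrix.SpecialLinearGroup.coe_mul, Matrix.mul_apply, Fin.sum_univ_two]
    fin_cases i <;> fin_cases j <;> simp [parabolic] <;> ring

/-- A subgroup of finite index contains parabolic transformations fixing a given cusp. -/
theorem exists_mem_fix_orient (Γ : Subgroup SL(2, ℤ)) [Γ.FiniteIndex] {a b : Cusp} (h : a ≠ b) :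
    ∃ γ ∈ Γ, deck γ a = a ∧ 0 < orient a b (deck γ b) := by
  obtain ⟨n, hn, -, hmem⟩ := Subgroup.exists_pow_mem_of_index_ne_zero
    (Subgroup.FiniteIndex.index_ne_zero (H := Γ)) (parabolic a 1)
  rw [parabolic_pow] at hmem
  obtain ⟨ε, hε, h1, h2⟩ := vec_deck (parabolic a n) a
  obtain ⟨ε', hε', h3, h4⟩ := vec_deck (parabolic a n) b
  simp only [parabolic, Matrix.SpecialLinearGroup.coe_mk, Matrix.of_apply, Matrix.cons_val_zero,
    Matrix.cons_val_one, Matrix.cons_val', Matrix.cons_val_fin_one] at h1 h2 h3 h4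
  refine ⟨_, hmem, ?_, ?_⟩
  · rw [← delta_eq_zero_iff, delta, parabolic, h1, h2]
    ring
  · rw [orient_pos_iff_delta]
    have hd : delta a b ≠ 0 := fun h0 => h ((delta_eq_zero_iff a b).1 h0)
    -- The orientation is, up to a positive square, `n * delta a b ^ 4`: a positive power of the
    -- parabolic moves every other cusp in the same direction.
    have : delta a b * delta b (deck (parabolic a n) b) * delta (deck (parabolic a n) b) a =
        (ε' * ε') * (n * delta a b ^ 4) := by
      simp only [delta, parabolic]
      rw [h3, h4]
      ring
    rw [this, hε', one_mul]
    positivity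

/-- The primitive vectors of `a` and `b` are independent eigenvectors with eigenvalues `±1`, so the
square fixes a basis of `ℚ²`. -/
theorem mul_self_eq_one_of_deck_fix {γ : SL(2, ℤ)} {a b : Cusp} (h : a ≠ b) (ha : deck γ a = a)
    (hb : deck γ b = b) : γ * γ = 1 := by
  have hd : delta a b ≠ 0 := fun h0 => h ((delta_eq_zero_iff a b).1 h0)
  obtain ⟨ε, hε, h1, h2⟩ := vec_deck γ a
  obtain ⟨ε', hε', h3, h4⟩ := vec_deck γ b
  rw [ha] at h1 h2
  rw [hb] at h3 h4
  have key : ∀ (M : Matrix (Fin 2) (Fin 2) ℤ) (i : Fin 2) (s t : ℤ),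
      M i 0 * (vec a).1 + M i 1 * (vec a).2 = s * (vec a).1 + t * (vec a).2 →
      M i 0 * (vec b).1 + M i 1 * (vec b).2 = s * (vec b).1 + t * (vec b).2 →
      M i 0 = s ∧ M i 1 = t := by
    intro M i s t e1 e2
    constructor
    · apply mul_left_cancel₀ hd
      simp only [delta]
      linear_combination (vec b).2 * e1 - (vec a).2 * e2
    · apply mul_left_cancel₀ hd
      simp only [delta]
      linear_combination (-(vec b).1) * e1 + (vec a).1 * e2
  have e1 : γ 0 0 * (vec a).1 + γ 0 1 * (vec a).2 = ε * (vec a).1 := by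
    linear_combination (-ε) * h1 - (γ 0 0 * (vec a).1 + γ 0 1 * (vec a).2) * hε
  have e2 : γ 1 0 * (vec a).1 + γ 1 1 * (vec a).2 = ε * (vec a).2 := by
    linear_combination (-ε) * h2 - (γ 1 0 * (vec a).1 + γ 1 1 * (vec a).2) * hε
  have e3 : γ 0 0 * (vec b).1 + γ 0 1 * (vec b).2 = ε' * (vec b).1 := by
    linear_combination (-ε') * h3 - (γ 0 0 * (vec b).1 + γ 0 1 * (vec b).2) * hε'
  have e4 : γ 1 0 * (vec b).1 + γ 1 1 * (vec b).2 = ε' * (vec b).2 := by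
    linear_combination (-ε') * h4 - (γ 1 0 * (vec b).1 + γ 1 1 * (vec b).2) * hε'
  have f1 := key (γ * γ).1 0 1 0 (by
      simp only [Matrix.SpecialLinearGroup.coe_mul, Matrix.mul_apply, Fin.sum_univ_two]
      linear_combination γ 0 0 * e1 + γ 0 1 * e2 + ε * e1 + (vec a).1 * hε) (by
      simp only [Matrix.SpecialLinearGroup.coe_mul, Matrix.mul_apply, Fin.sum_univ_two]
      linear_combination γ 0 0 * e3 + γ 0 1 * e4 + ε' * e3 + (vec b).1 * hε')
  have f2 := key (γ * γ).1 1 0 1 (by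
      simp only [Matrix.SpecialLinearGroup.coe_mul, Matrix.mul_apply, Fin.sum_univ_two]
      linear_combination γ 1 0 * e1 + γ 1 1 * e2 + ε * e2 + (vec a).2 * hε) (by
      simp only [Matrix.SpecialLinearGroup.coe_mul, Matrix.mul_apply, Fin.sum_univ_two]
      linear_combination γ 1 0 * e3 + γ 1 1 * e4 + ε' * e4 + (vec b).2 * hε')
  ext i j
  fin_cases i <;> fin_cases j
  · exact f1.1
  · exact f1.2
  · exact f2.1
  · exact f2.2

/-! ### Finiteness of crossings, and the triangles beside an edge. -/

/-- Ptolemy's relation for the quadrilateral with diagonals `xy` and `pq`. Crossing forces the two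
products on the right of the Plücker relation to have opposite signs, so their absolute values add
up. -/
theorem Crosses.abs_delta_mul {x y p q : Cusp} (h : Crosses x y p q) :
    |delta x y| * |delta p q| =
      |delta x p| * |delta y q| + |delta x q| * |delta y p| := by
  have key : ∀ x y p q : Cusp, 0 < orient x y p → 0 < orient y x q →
      (delta x p * delta y q) * (delta x q * delta y p) < 0 := by
    intro x y p q h1 h2
    rw [orient_pos_iff_delta] at h1 h2
    have h3 := mul_pos h1 h2
    rw [delta_swap x y, delta_swap x p, delta_swap y q] at h3
    have h4 : delta x y * delta y p * -delta x p * (-delta x y * delta x q * -delta y q) =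
        (delta x y ^ 2) * (-((delta x p * delta y q) * (delta x q * delta y p))) := by ring
    rw [h4] at h3
    have := pos_of_mul_pos_right h3 (sq_nonneg _)
    linarith
  have h5 : (delta x p * delta y q) * (delta x q * delta y p) < 0 := by
    rcases (crosses_iff x y p q).1 h with ⟨h1, h2⟩ | ⟨h1, h2⟩
    · exact key x y p q h1 h2
    · have := key y x p q h1 h2
      linarith
  rw [← abs_mul, delta_plucker, ← abs_mul, ← abs_mul]
  rcases mul_neg_iff.1 h5 with ⟨h1, h2⟩ | ⟨h1, h2⟩
  · rw [abs_of_pos h1, abs_of_neg h2, abs_of_pos (by linarith)]; ring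
  · rw [abs_of_neg h1, abs_of_pos h2, abs_of_neg (by linarith)]; ring

theorem crosses_iff_cut {κ : Cusp → ℚ} (hκ : ∀ a b c, 0 < orient a b c ↔ IsCyc κ a b c)
    (a b c d : Cusp) : Crosses a b c d ↔
      (IsCyc κ a b c ∧ IsCyc κ b a d) ∨ (IsCyc κ b a c ∧ IsCyc κ a b d) := by
  rw [crosses_iff, hκ, hκ, hκ, hκ]

namespace IdealTriangulation

variable {Γ : Subgroup SL(2, ℤ)} (T : IdealTriangulation Γ)

/-- Deck transformations preserve `|delta|`, and there are finitely many orbits of edges. -/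
theorem exists_abs_delta_le : ∃ N : ℤ, ∀ a b, T.Edge a b → |delta a b| ≤ N := by
  obtain ⟨F, hF, h⟩ := T.finite_orbits
  obtain ⟨N, hN⟩ := (hF.image fun x => |delta x.1 x.2|).bddAbove
  refine ⟨N, fun a b hab => ?_⟩
  obtain ⟨γ, -, hγ⟩ := h a b hab
  rw [← abs_delta_deck γ]
  exact hN ⟨_, hγ, rfl⟩

/-- The edges which cross a given geodesic. -/
def crossing (p q : Cusp) : Set (Cusp × Cusp) :=
  {x | T.Edge x.1 x.2 ∧ Crosses x.1 x.2 p q}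

theorem finite_crossing (p q : Cusp) : (T.crossing p q).Finite := by
  obtain ⟨N, hN⟩ := T.exists_abs_delta_le
  by_cases hpq : p = q
  · convert Set.finite_empty
    ext x
    simp only [crossing, Set.mem_ofPred_eq, Set.mem_empty_iff_false, iff_false, not_and, hpq,
      Crosses]
    intro _
    nlinarith [mul_self_nonneg (orient x.1 x.2 q)]
  have hfin := finite_of_delta_le hpq (N * |delta p q|)
  refine (hfin.prod hfin).subset ?_
  rintro ⟨x, y⟩ ⟨he, hc⟩
  dsimp only at he hc
  have hpt := hc.abs_delta_mul
  have hle : |delta x y| * |delta p q| ≤ N * |delta p q| :=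
    mul_le_mul_of_nonneg_right (hN _ _ he) (abs_nonneg _)
  have hne : ∀ a b c : Cusp, 0 < orient a b c → a ≠ c ∧ b ≠ c := by
    intro a b c h
    constructor <;> rintro rfl <;> simp [orient, bracket, mul_comm] at h
  have hd : x ≠ p ∧ y ≠ p ∧ x ≠ q ∧ y ≠ q := by
    rcases (crosses_iff x y p q).1 hc with ⟨h1, h2⟩ | ⟨h1, h2⟩
    · exact ⟨(hne _ _ _ h1).1, (hne _ _ _ h1).2, (hne _ _ _ h2).2, (hne _ _ _ h2).1⟩
    · exact ⟨(hne _ _ _ h1).2, (hne _ _ _ h1).1, (hne _ _ _ h2).1, (hne _ _ _ h2).2⟩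
  have h1 := abs_delta_pos hd.1
  have h2 := abs_delta_pos hd.2.1
  have h3 := abs_delta_pos hd.2.2.1
  have h4 := abs_delta_pos hd.2.2.2
  have hs : ∀ a b, |delta a b| = |delta b a| := fun a b => by rw [delta_swap, abs_neg]
  simp only [Set.mem_prod, Set.mem_ofPred_eq]
  rw [hs p x, hs q x, hs p y, hs q y]
  -- The four factors in Ptolemy's relation are positive integers, so each is bounded by `N * |delta
  -- p q|`; this confines both ends of the edge to a finite set.
  refine ⟨⟨?_, ?_⟩, ⟨?_, ?_⟩⟩ <;> nlinarith

variable {T}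

theorem Edge.symm {a b : Cusp} (h : T.Edge a b) : T.Edge b a := T.symm a b h

/-- If there is an edge `ac` on the left of the edge `ab`, then there is a triangle on the left of
`ab`. -/
theorem exists_isTriangle_of_orient {a b : Cusp} (hab : T.Edge a b) (n : ℕ) : ∀ c : Cusp,
    T.Edge a c → 0 < orient a b c → (T.crossing b c).ncard = n → ∃ c', T.IsTriangle a b c' := by
  induction n using Nat.strong_induction_on with
  | _ n ih =>
    intro c hac ho hn
    obtain ⟨κ, hinj, hmax, hκ⟩ := exists_cut a
    have hcr := crosses_iff_cut hκ
    have hne : b ≠ c := by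
      rintro rfl
      simp [orient, bracket, mul_comm] at ho
    by_cases hmx : ∀ x y, T.Edge x y → ¬ Crosses b c x y
    · exact ⟨c, hab, T.maximal b c hne hmx, hac.symm, ho⟩
    push Not at hmx
    obtain ⟨x, y, hxy, hc⟩ := hmx
    have hlt : ∀ x, x ≠ a → κ x < κ a := fun x hx =>
      lt_of_le_of_ne (hmax x) fun h => hx (hinj h)
    rw [hκ] at ho
    -- An edge crossing `bc` can leave the triangle `abc` neither through `ab` nor through `ac`, so
    -- it ends at `a`; its other end `d` lies beyond `bc`.
    obtain ⟨d, had, h1, h2⟩ : ∃ d, T.Edge a d ∧ κ b < κ d ∧ κ d < κ c := by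
      have n1 := T.noncrossing _ _ _ _ hab hxy
      have n2 := T.noncrossing _ _ _ _ hac hxy
      rw [hcr] at hc n1 n2
      have hx := hmax x
      have hy := hmax y
      have hx' := @hinj x a
      have hy' := @hinj y a
      simp only [IsCyc] at *
      by_cases hxa : x = a
      · subst hxa
        exact ⟨y, hxy, by grind⟩
      · by_cases hya : y = a
        · subst hya
          exact ⟨x, hxy.symm, by grind⟩
        · exfalso
          have := hlt x hxa
          have := hlt y hya
          grind
    have hb := hmax b
    have hc' := hmax c
    refine ih _ ?_ d had ?_ rfl
    -- Descent on the number of edges crossing the third side: an edge crossing `bd` avoids `ab` and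
    -- `ad`, hence crosses `bc`, while `ad` crosses `bc` but not `bd`.
    · rw [← hn]
      refine Set.ncard_lt_ncard ?_ (T.finite_crossing b c)
      refine (Set.ssubset_iff_of_subset ?_).2 ⟨(a, d), ⟨had, ?_⟩, ?_⟩
      · rintro ⟨x, y⟩ ⟨hxy, hc⟩
        refine ⟨hxy, ?_⟩
        dsimp only at hxy hc ⊢
        have n1 := T.noncrossing _ _ _ _ hab hxy
        have n2 := T.noncrossing _ _ _ _ had hxy
        rw [hcr] at hc n1 n2 ⊢
        have hx := hmax x
        have hy := hmax y
        simp only [IsCyc] at *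
        grind
      · dsimp only
        rw [hcr]
        simp only [IsCyc] at *
        grind
      · rintro ⟨-, hc⟩
        dsimp only at hc
        rw [hcr] at hc
        simp only [IsCyc] at *
        grind
    · rw [hκ]
      simp only [IsCyc] at *
      grind

/-- A parabolic element of `Γ` fixing `a` moves the edge `ab` to an edge from `a` on its left, from
which the descent can start. -/
theorem exists_isTriangle [Γ.FiniteIndex] {a b : Cusp} (hab : T.Edge a b) :
    ∃ c, T.IsTriangle a b c := by
  obtain ⟨γ, hγ, ha, ho⟩ := exists_mem_fix_orient Γ (T.ne_of_edge _ _ hab)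
  refine exists_isTriangle_of_orient hab _ (deck γ b) ?_ ho rfl
  have := T.invariant γ hγ _ _ hab
  rwa [ha] at this

theorem IsTriangle.rotate {a b c : Cusp} (h : T.IsTriangle a b c) : T.IsTriangle b c a :=
  ⟨h.2.1, h.2.2.1, h.1, by rw [orient_rotate]; exact h.2.2.2⟩

/-- With two different third vertices on the same side of `ab`, a side of one triangle would cross a
side of the other. -/
theorem IsTriangle.unique {a b c c' : Cusp} (h : T.IsTriangle a b c) (h' : T.IsTriangle a b c') :
    c = c' := by
  obtain ⟨κ, hinj, hmax, hκ⟩ := exists_cut a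
  obtain ⟨h1, h2, h3, h4⟩ := h
  obtain ⟨h1', h2', h3', h4'⟩ := h'
  have n1 := T.noncrossing _ _ _ _ h2 h3'
  have n2 := T.noncrossing _ _ _ _ h2' h3
  rw [crosses_iff_cut hκ] at n1 n2
  rw [hκ] at h4 h4'
  have := hmax b
  have := hmax c
  have := hmax c'
  apply hinj
  simp only [IsCyc] at *
  grind

theorem IsTriangle.deck {a b c : Cusp} (h : T.IsTriangle a b c) {γ : SL(2, ℤ)} (hγ : γ ∈ Γ) :
    T.IsTriangle (deck γ a) (deck γ b) (deck γ c) :=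
  ⟨T.invariant γ hγ _ _ h.1, T.invariant γ hγ _ _ h.2.1, T.invariant γ hγ _ _ h.2.2.1,
    (orient_deck_pos_iff γ a b c).2 h.2.2.2⟩

end IdealTriangulation

/-! ### Oriented edges and walks across triangles. -/

namespace IdealTriangulation

variable {Γ : Subgroup SL(2, ℤ)} (T : IdealTriangulation Γ)

/-- Oriented edges of the lifted triangulation, together with the triangle on their left. -/
@[ext]
structure OrientedEdge where
  src : Cusp
  tgt : Cusp
  edge : T.Edge src tgt

/-- An empty system would not be maximal: any geodesic could be added. -/
theorem nonempty_orientedEdge : Nonempty T.OrientedEdge := by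
  by_cases h : ∃ a b, T.Edge a b
  · obtain ⟨a, b, hab⟩ := h
    exact ⟨⟨a, b, hab⟩⟩
  · push Not at h
    exact ⟨⟨OnePoint.infty, ((0 : ℚ) : Cusp), T.maximal _ _ (OnePoint.infty_ne_coe 0)
      fun c d hcd => absurd hcd (h c d)⟩⟩

namespace OrientedEdge

variable {T}

/-- The edge with the opposite orientation. -/
def flip (e : T.OrientedEdge) : T.OrientedEdge := ⟨e.tgt, e.src, e.edge.symm⟩

@[simp]
theorem flip_flip (e : T.OrientedEdge) : e.flip.flip = e := rfl

/-- The action of a deck transformation. -/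
def act (γ : Γ) (e : T.OrientedEdge) : T.OrientedEdge :=
  ⟨deck γ e.src, deck γ e.tgt, T.invariant γ γ.2 _ _ e.edge⟩

theorem act_flip (γ : Γ) (e : T.OrientedEdge) : e.flip.act γ = (e.act γ).flip := rfl

theorem eq_one_of_act_eq (hΓ : ∀ γ ∈ Γ, IsOfFinOrder γ → γ = 1) {γ : Γ} {e : T.OrientedEdge}
    (h : e.act γ = e) : γ = 1 := by
  have hsq := mul_self_eq_one_of_deck_fix (T.ne_of_edge _ _ e.edge) (congrArg src h)
    (congrArg tgt h)
  exact Subtype.ext (hΓ γ γ.2 (isOfFinOrder_iff_pow_eq_one.2 ⟨2, two_pos, by rw [sq, hsq]⟩))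

theorem act_act (γ δ : Γ) (e : T.OrientedEdge) : (e.act δ).act γ = e.act (γ * δ) := by
  simp [act, deck_mul]

theorem act_one (e : T.OrientedEdge) : e.act 1 = e := by
  simp [act, deck_one]

theorem eq_one_of_pow_act_eq (hΓ : ∀ γ ∈ Γ, IsOfFinOrder γ → γ = 1) {γ : Γ} {e : T.OrientedEdge}
    {n : ℕ} (hn : 0 < n) (h : e.act (γ ^ n) = e) : γ = 1 := by
  have hpow := eq_one_of_act_eq hΓ h
  refine Subtype.ext (hΓ γ γ.2 (isOfFinOrder_iff_pow_eq_one.2 ⟨n, hn, ?_⟩))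
  simpa using congrArg Subtype.val hpow

variable [Γ.FiniteIndex]

/-- The third vertex of the triangle on the left. -/
def third (e : T.OrientedEdge) : Cusp := (exists_isTriangle e.edge).choose

theorem isTriangle (e : T.OrientedEdge) : T.IsTriangle e.src e.tgt e.third :=
  (exists_isTriangle e.edge).choose_spec

/-- The next side of the triangle on the left. -/
def turn (e : T.OrientedEdge) : T.OrientedEdge := ⟨e.tgt, e.third, e.isTriangle.2.1⟩

theorem third_turn (e : T.OrientedEdge) : e.turn.third = e.src :=
  e.turn.isTriangle.unique e.isTriangle.rotate

theorem turn_turn_turn (e : T.OrientedEdge) : e.turn.turn.turn = e := by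
  ext
  · exact e.third_turn
  · exact e.turn.third_turn

theorem third_act (γ : Γ) (e : T.OrientedEdge) : (e.act γ).third = deck γ e.third :=
  (e.act γ).isTriangle.unique (e.isTriangle.deck γ.2)

theorem act_turn (γ : Γ) (e : T.OrientedEdge) : e.turn.act γ = (e.act γ).turn := by
  ext
  · rfl
  · exact (e.third_act γ).symm

/-- One of the two other sides of the triangle on the left. -/
def rot (i : Bool) (e : T.OrientedEdge) : T.OrientedEdge := if i then e.turn.turn else e.turn

theorem rot_not_rot (i : Bool) (e : T.OrientedEdge) : (e.rot i).rot (!i) = e := by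
  cases i <;> simp [rot, turn_turn_turn]

theorem rot_rot (i : Bool) (e : T.OrientedEdge) : (e.rot i).rot i = e.rot (!i) := by
  cases i <;> simp [rot, turn_turn_turn]

theorem act_rot (γ : Γ) (i : Bool) (e : T.OrientedEdge) : (e.rot i).act γ = (e.act γ).rot i := by
  cases i <;> simp [rot, act_turn]

/-- Cross the triangle on the left and leave it through one of the two other sides. -/
def step (e : T.OrientedEdge) (i : Bool) : T.OrientedEdge := (e.rot i).flip

theorem act_step (γ : Γ) (i : Bool) (e : T.OrientedEdge) :
    (e.step i).act γ = (e.act γ).step i := by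
  rw [step, act_flip, act_rot, step]

theorem step_true_src (e : T.OrientedEdge) : (e.step true).src = e.src := e.third_turn

theorem step_true_tgt (e : T.OrientedEdge) : (e.step true).tgt = e.third := by
  simp [step, rot, flip, turn]

theorem step_false_src (e : T.OrientedEdge) : (e.step false).src = e.third := by
  simp [step, rot, flip, turn]

theorem step_false_tgt (e : T.OrientedEdge) : (e.step false).tgt = e.tgt := by
  simp [step, rot, flip, turn]

/-- Follow a sequence of left and right turns. -/
def walk (e : T.OrientedEdge) (w : List Bool) : T.OrientedEdge := w.foldl step e

theorem walk_cons (e : T.OrientedEdge) (i : Bool) (w : List Bool) :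
    e.walk (i :: w) = (e.step i).walk w := rfl

theorem walk_concat (e : T.OrientedEdge) (i : Bool) (w : List Bool) :
    e.walk (w ++ [i]) = (e.walk w).step i := by
  simp [walk, List.foldl_append]

/-- A geodesic leads from an edge to any edge on its left. -/
theorem exists_walk_of_nested {κ : Cusp → ℚ} (hinj : Function.Injective κ)
    (hκ : ∀ a b c, 0 < orient a b c ↔ IsCyc κ a b c) {p : Cusp} (hp : ∀ x, κ x ≤ κ p)
    {f : T.OrientedEdge} (hf : κ f.tgt < κ f.src) (n : ℕ) :
    ∀ e : T.OrientedEdge, κ e.tgt ≤ κ f.tgt → κ f.src ≤ κ e.src → κ e.src < κ p →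
      {x ∈ T.crossing p f.third | κ e.tgt ≤ κ x.2 ∧ κ x.1 ≤ κ e.src}.ncard = n →
      ∃ w, e.walk w = f := by
  induction n using Nat.strong_induction_on with
  | _ n ih =>
    intro e h1 h2 h3 hn
    have hcr := crosses_iff_cut hκ
    have hq := f.isTriangle.2.2.2
    have hc := e.isTriangle.2.2.2
    have hqp := hp f.third
    have hcp := hp e.third
    rw [hκ] at hq hc
    -- The induction counts the edges between `e` and `f` that cross the geodesic from `p`, behind
    -- `e`, to the vertex beyond `f`. The edge `e` itself is counted, and it drops out after one
    -- step.
    have hmem : (e.src, e.tgt) ∈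
        {x ∈ T.crossing p f.third | κ e.tgt ≤ κ x.2 ∧ κ x.1 ≤ κ e.src} := by
      refine ⟨⟨e.edge, ?_⟩, le_refl _, le_refl _⟩
      rw [hcr]
      simp only [IsCyc] at *
      grind
    have hfin : {x ∈ T.crossing p f.third | κ e.tgt ≤ κ x.2 ∧ κ x.1 ≤ κ e.src}.Finite :=
      (T.finite_crossing p f.third).subset (Set.sep_subset _ _)
    by_cases hef : κ e.tgt = κ f.tgt ∧ κ f.src = κ e.src
    · exact ⟨[], by ext; exacts [(hinj hef.2).symm, hinj hef.1]⟩
    have n1 := T.noncrossing _ _ _ _ e.isTriangle.2.1 f.edge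
    have n2 := T.noncrossing _ _ _ _ e.isTriangle.2.2.1 f.edge
    rw [hcr] at n1 n2
    -- The sides of the triangle do not cross `f`, so its third vertex is not strictly between the
    -- ends of `f`; its position tells which side to leave through.
    have hlr : κ e.third ≤ κ f.tgt ∨ κ f.src ≤ κ e.third := by
      simp only [IsCyc] at *
      grind
    have hbc : κ e.tgt < κ e.third ∧ κ e.third < κ e.src := by
      simp only [IsCyc] at *
      grind
    rcases hlr with h | h
    · suffices h : ∃ w, (e.step true).walk w = f from h.imp' (List.cons true) fun _ hw => hw
      refine ih _ ?_ (e.step true) (by rwa [step_true_tgt]) (by rwa [step_true_src])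
        (by rwa [step_true_src]) rfl
      rw [← hn, step_true_tgt, step_true_src]
      refine Set.ncard_lt_ncard ((Set.ssubset_iff_of_subset ?_).2 ⟨_, hmem, ?_⟩) hfin
      · exact fun x hx => ⟨hx.1, hbc.1.le.trans hx.2.1, hx.2.2⟩
      · exact fun hx => hbc.1.not_ge hx.2.1
    · suffices h : ∃ w, (e.step false).walk w = f from h.imp' (List.cons false) fun _ hw => hw
      refine ih _ ?_ (e.step false) (by rwa [step_false_tgt]) (by rwa [step_false_src])
        (by rw [step_false_src]; exact hbc.2.trans h3) rfl
      rw [← hn, step_false_tgt, step_false_src]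
      refine Set.ncard_lt_ncard ((Set.ssubset_iff_of_subset ?_).2 ⟨_, hmem, ?_⟩) hfin
      · exact fun x hx => ⟨hx.1, hx.2.1, hx.2.2.trans hbc.2.le⟩
      · exact fun hx => hbc.2.not_ge hx.2.2

/-- Cutting the circle at the third vertex of the triangle behind `e` places both ends of `f` in the
interval spanned by `e`. The two alternatives are the two possible orientations of `f`. -/
theorem exists_walk_of_left {e f : T.OrientedEdge} (h1 : ¬ 0 < orient e.tgt e.src f.src)
    (h2 : ¬ 0 < orient e.tgt e.src f.tgt) :
    (∃ w, e.walk w = f) ∨ ∃ w, e.walk w = f.flip := by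
  obtain ⟨κ, hinj, hmax, hκ⟩ := exists_cut e.flip.third
  have hp := e.flip.isTriangle.2.2.2
  change 0 < orient e.tgt e.src e.flip.third at hp
  have hne := T.ne_of_edge _ _ f.edge
  have hne' : κ f.src ≠ κ f.tgt := fun h => hne (hinj h)
  have hs := hmax f.src
  have ht := hmax f.tgt
  have hs' := hmax e.src
  have ht' := hmax e.tgt
  rw [hκ] at h1 h2 hp
  have h : κ e.tgt ≤ κ f.src ∧ κ f.src ≤ κ e.src ∧ κ e.tgt ≤ κ f.tgt ∧ κ f.tgt ≤ κ e.src ∧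
      κ e.src < κ e.flip.third := by
    have i1 := @hinj f.src e.flip.third
    have i2 := @hinj f.tgt e.flip.third
    simp only [IsCyc] at *
    grind
  obtain ⟨k1, k2, k3, k4, k5⟩ := h
  rcases lt_or_gt_of_ne hne' with hlt | hlt
  · exact Or.inr (exists_walk_of_nested hinj hκ hmax (f := f.flip) hlt _ e k1 k4 k5
      rfl)
  · exact Or.inl (exists_walk_of_nested hinj hκ hmax hlt _ e k3 k2 k5 rfl)

theorem exists_walk (e f : T.OrientedEdge) :
    ((∃ w, e.walk w = f) ∨ ∃ w, e.walk w = f.flip) ∨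
      ((∃ w, e.flip.walk w = f) ∨ ∃ w, e.flip.walk w = f.flip) := by
  have h := T.noncrossing _ _ _ _ e.edge f.edge
  rw [crosses_iff] at h
  have h1 := orient_swap e.src e.tgt f.src
  have h2 := orient_swap e.src e.tgt f.tgt
  have h3 : (¬ 0 < orient e.tgt e.src f.src ∧ ¬ 0 < orient e.tgt e.src f.tgt) ∨
      (¬ 0 < orient e.src e.tgt f.src ∧ ¬ 0 < orient e.src e.tgt f.tgt) := by
    grind
  rcases h3 with ⟨h4, h5⟩ | ⟨h4, h5⟩
  · exact Or.inl (exists_walk_of_left h4 h5)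
  · exact Or.inr (exists_walk_of_left (e := e.flip) h4 h5)

/-- Here `e` and its translate face each other. The first and last turns of the walk are taken in
triangles that are translates of one another, so replacing `e` by `e.step i` absorbs both: the
result is either a walk to a translate with the right orientation or a shorter facing walk. -/
theorem exists_walk_of_facing (hΓ : ∀ γ ∈ Γ, IsOfFinOrder γ → γ = 1) (γ : Γ) (n : ℕ) :
    ∀ (w : List Bool) (e : T.OrientedEdge), w.length = n → e.walk w = (e.act γ).flip →
      ∃ (e' : T.OrientedEdge) (w' : List Bool), e'.walk w' = e'.act γ := by
  induction n using Nat.strong_induction_on with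
  | _ n ih =>
    intro w e hn hw
    have hone : γ = 1 → ∃ (e' : T.OrientedEdge) (w' : List Bool), e'.walk w' = e'.act γ := by
      rintro rfl
      exact ⟨e, [], (act_one e).symm⟩
    rcases w with _ | ⟨i, w⟩
    -- With no turn, `γ` reverses `e`, so `γ ^ 2` fixes it.
    · refine hone (eq_one_of_pow_act_eq hΓ (e := e) two_pos ?_)
      have h : e.act γ = e.flip := by
        rw [← flip_flip (e.act γ), ← hw]; rfl
      rw [sq, ← act_act, h, act_flip, h, flip_flip]
    rcases List.eq_nil_or_concat w with rfl | ⟨w', j, rfl⟩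
    -- With one turn, `γ` rotates the triangle on the left of `e`, so `γ ^ 3` fixes `e`.
    · refine hone (eq_one_of_pow_act_eq hΓ (e := e) three_pos ?_)
      have h : e.act γ = e.rot i := by
        rw [← flip_flip (e.act γ), ← hw]; rfl
      rw [pow_three, ← act_act, ← act_act, h, act_rot, h, act_rot, act_rot, h, rot_rot]
      exact rot_not_rot i e
    rw [walk_cons, List.concat_eq_append, walk_concat] at hw
    have h : ((e.step i).walk w').rot j = e.act γ := by
      rw [← flip_flip (e.act γ), ← hw]; rfl
    -- For equal turns, the walk re-enters the last triangle at the side from which the opposite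
    -- turn leads to the translate of `e.step i`. For opposite turns, it has already reached that
    -- translate, with reversed orientation.
    by_cases hij : i = j
    · subst hij
      refine ⟨e.step i, w' ++ [!i], ?_⟩
      rw [walk_concat, act_step, ← h]
      simp only [step, rot_rot]
    · have hj : j = !i := by cases i <;> cases j <;> simp_all
      subst hj
      refine ih w'.length ?_ w' (e.step i) rfl ?_
      · rw [← hn]; simp
      · rw [act_step, ← h, step, step, flip_flip]
        have := rot_not_rot (!i) ((e.rot i).flip.walk w')
        rw [Bool.not_not] at this
        exact this.symm

/-- A deck transformation is a product of left and right turns, from a suitable edge on. -/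
theorem exists_walk_eq_act (hΓ : ∀ γ ∈ Γ, IsOfFinOrder γ → γ = 1) (γ : Γ) :
    ∃ (e : T.OrientedEdge) (w : List Bool), e.walk w = e.act γ := by
  obtain ⟨e⟩ := T.nonempty_orientedEdge
  rcases e.exists_walk (e.act γ) with (⟨w, h⟩ | ⟨w, h⟩) | (⟨w, h⟩ | ⟨w, h⟩)
  · exact ⟨e, w, h⟩
  · exact exists_walk_of_facing hΓ γ _ w e rfl h
  · exact exists_walk_of_facing hΓ γ _ w e.flip rfl h
  · exact ⟨e.flip, w, h⟩

end OrientedEdge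

end IdealTriangulation

/-! ### Projective frames of triples of flags -/

section Flags

variable {K : Type u} [Field K]

/-- The determinant of vectors representing the points of two flags, and of a third vector. -/
def det2 (F G : Flag K) (v : Fin 3 → K) : K := (Matrix.of ![F.pt.rep, G.pt.rep, v]).det

/-- The coordinate system on `K³` given by the equations of the line of `F`, the line through the
points of `F` and `G`, and the line of `G`, normalized at the point of `H`. -/
def flagFrame (F G H : Flag K) : Matrix (Fin 3) (Fin 3) K :=
  Matrix.of ![(pairing F H)⁻¹ • F.ln.rep,
    -- The minus sign gives the point of `H` the coordinates `(1, -1, 1)`; with `(1, 1, 1)` the turn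
    -- matrices would have negative entries.
    -(det3 F G H)⁻¹ • ![F.pt.rep 1 * G.pt.rep 2 - F.pt.rep 2 * G.pt.rep 1,
      F.pt.rep 2 * G.pt.rep 0 - F.pt.rep 0 * G.pt.rep 2,
      F.pt.rep 0 * G.pt.rep 1 - F.pt.rep 1 * G.pt.rep 0],
    (pairing G H)⁻¹ • G.ln.rep]

theorem flagFrame_mulVec (F G H : Flag K) (v : Fin 3 → K) :
    (flagFrame F G H).mulVec v = ![(F.ln.rep ⬝ᵥ v) / pairing F H, -(det2 F G v) / det3 F G H,
      (G.ln.rep ⬝ᵥ v) / pairing G H] := by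
  ext i
  fin_cases i
  · simp [flagFrame, Matrix.mulVec, div_eq_inv_mul, dotProduct, Finset.mul_sum, mul_assoc]
  · simp [flagFrame, Matrix.mulVec, div_eq_inv_mul, det2, Matrix.det_fin_three, dotProduct,
      Fin.sum_univ_three]
    ring
  · simp [flagFrame, Matrix.mulVec, div_eq_inv_mul, dotProduct, Finset.mul_sum, mul_assoc]

theorem pairing_self (F : Flag K) : pairing F F = 0 := by
  have h := F.incident
  rw [← F.pt.mk_rep, ← F.ln.mk_rep, Projectivization.orthogonal_mk] at h
  rw [pairing, dotProduct_comm]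
  exact h

theorem det2_pt (F G H : Flag K) : det2 F G H.pt.rep = det3 F G H := rfl

theorem det3_rotate (F G H : Flag K) : det3 G H F = det3 F G H := by
  simp [det3, Matrix.det_fin_three]; ring

theorem det3_swap (F G H : Flag K) : det3 F H G = - det3 F G H := by
  simp [det3, Matrix.det_fin_three]; ring

theorem det3_right_eq (F G : Flag K) : det3 F G G = 0 := by
  simp [det3, Matrix.det_fin_three]; ring

theorem det3_outer_eq (F G : Flag K) : det3 F G F = 0 := by
  simp [det3, Matrix.det_fin_three]; ring

theorem matrix_ext_of_det3_ne_zero {F G H : Flag K} (h : det3 F G H ≠ 0)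
    {M N : Matrix (Fin 3) (Fin 3) K} (h1 : M.mulVec F.pt.rep = N.mulVec F.pt.rep)
    (h2 : M.mulVec G.pt.rep = N.mulVec G.pt.rep) (h3 : M.mulVec H.pt.rep = N.mulVec H.pt.rep) :
    M = N := by
  have hu : IsUnit (Matrix.of ![F.pt.rep, G.pt.rep, H.pt.rep]).transpose := by
    rw [Matrix.isUnit_iff_isUnit_det, Matrix.det_transpose]
    exact isUnit_iff_ne_zero.2 h
  refine hu.mul_right_cancel ?_
  ext i j
  fin_cases j
  · exact congrFun h1 i
  · exact congrFun h2 i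
  · exact congrFun h3 i

theorem flagFrame_mulVec_pt (F G H J : Flag K) :
    (flagFrame F G H).mulVec J.pt.rep = ![pairing F J / pairing F H, -(det3 F G J) / det3 F G H,
      pairing G J / pairing G H] :=
  flagFrame_mulVec F G H J.pt.rep

/-- Flags at the vertices of a triangle in general position. -/
structure Generic (F G H : Flag K) : Prop where
  fg : pairing F G ≠ 0
  gf : pairing G F ≠ 0
  gh : pairing G H ≠ 0
  hg : pairing H G ≠ 0
  hf : pairing H F ≠ 0
  fh : pairing F H ≠ 0
  det : det3 F G H ≠ 0

/-- In this frame the points of `F` and `G` lie on the third and first coordinate axes and the point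
of `H` is `(1, -1, 1)`, so no non-zero functional kills all three. -/
theorem det_flagFrame_ne_zero {F G H : Flag K} (h : Generic F G H) :
    (flagFrame F G H).det ≠ 0 := by
  intro h0
  obtain ⟨v, hv, hv0⟩ := Matrix.exists_vecMul_eq_zero_iff.2 h0
  have key : ∀ J : Flag K, v ⬝ᵥ (flagFrame F G H).mulVec J.pt.rep = 0 := by
    intro J
    rw [Matrix.dotProduct_mulVec, hv0, zero_dotProduct]
  have h1 := key F
  have h2 := key G
  have h3 := key H
  rw [flagFrame_mulVec_pt] at h1 h2 h3
  simp only [dotProduct, Fin.sum_univ_three, pairing_self, det3_right_eq, det3_outer_eq,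
    Matrix.cons_val_zero, Matrix.cons_val_one, Matrix.cons_val, zero_div, neg_zero, mul_zero,
    zero_add, add_zero, div_self h.fh, div_self h.gh, div_self h.det, neg_div, mul_one, mul_neg,
    mul_eq_zero, div_eq_zero_iff, h.gf, h.gh, h.fg, h.fh, or_false] at h1 h2 h3
  apply hv
  ext i
  fin_cases i
  · exact h2
  · simpa [h1, h2] using h3
  · exact h1

/-- The matrix of a right turn: `x` is a triple ratio, `z` and `z'⁻¹` are edge coordinates. -/
def rightTurn {R : Type*} [CommSemiring R] (x z z' : R) : Matrix (Fin 3) (Fin 3) R :=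
  !![z, 0, 0; 1, 1, 0; z', z' * (1 + x), z' * x]

/-- The matrix of a left turn: `x⁻¹` is a triple ratio, `z` and `z'⁻¹` are edge coordinates. -/
def leftTurn {R : Type*} [CommSemiring R] (x z z' : R) : Matrix (Fin 3) (Fin 3) R :=
  !![z * x, z * (1 + x), z; 0, 1, 1; 0, 0, z']

/-- The line of `F` is kept, and the lines `FH` and of `H` are expressed in the old frame; it
suffices to compare values at the points of `F`, `G`, `H`. The triple ratio fixes the line of `H`,
and the edge coordinates record the change of normalization from `H` to `J`. -/
theorem flagFrame_rightTurn {F G H J : Flag K} (h : Generic F G H) (h' : Generic F H J) :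
    flagFrame F H J = (det3 F G H * pairing F H / (det3 F H J * pairing F G)) •
      (rightTurn (tripleRatio F G H) (edgeRatio F G H J) (edgeRatio H J F G)⁻¹ *
        flagFrame F G H) := by
  have h1 := h.fg; have h2 := h.gf; have h3 := h.gh; have h4 := h.hg; have h5 := h.hf
  have h6 := h.fh; have h7 := h.det
  have k1 := h'.fh; have k2 := h'.gh; have k3 := h'.det
  have d1 : det3 H F G = det3 F G H := by rw [det3_rotate, det3_rotate]
  have d2 : det3 H J F = det3 F H J := det3_rotate F H J
  refine matrix_ext_of_det3_ne_zero h.det ?_ ?_ ?_ <;>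
  · rw [Matrix.smul_mulVec, ← Matrix.mulVec_mulVec, flagFrame_mulVec_pt, flagFrame_mulVec_pt]
    ext i
    fin_cases i <;>
      simp [rightTurn, tripleRatio, edgeRatio, h1, h6, h7, k3,
        pairing_self, det3_right_eq, det3_outer_eq, d1, d2, det3_swap F G H] <;>
      field_simp <;> ring

theorem flagFrame_leftTurn {F G H J : Flag K} (h : Generic F G H) (h' : Generic H G J) :
    flagFrame H G J = (det3 F G H * pairing G H / (det3 H G J * pairing G F)) •
      (leftTurn (tripleRatio F G H)⁻¹ (edgeRatio H F G J) (edgeRatio G J H F)⁻¹ *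
        flagFrame F G H) := by
  have h1 := h.fg; have h2 := h.gf; have h3 := h.gh; have h4 := h.hg; have h5 := h.hf
  have h6 := h.fh; have h7 := h.det
  have k1 := h'.fh; have k2 := h'.gh; have k3 := h'.det
  have d1 : det3 H F G = det3 F G H := by rw [det3_rotate, det3_rotate]
  have d2 : det3 G J H = det3 H G J := det3_rotate H G J
  have d3 : det3 G H F = det3 F G H := det3_rotate F G H
  have d4 : det3 H G F = - det3 F G H := by rw [← d1, det3_swap]
  refine matrix_ext_of_det3_ne_zero h.det ?_ ?_ ?_ <;>
  · rw [Matrix.smul_mulVec, ← Matrix.mulVec_mulVec, flagFrame_mulVec_pt, flagFrame_mulVec_pt]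
    ext i
    fin_cases i <;>
      simp [leftTurn, tripleRatio, edgeRatio, h2, h3, h7, k3,
        pairing_self, det3_right_eq, det3_outer_eq, d1, d2, d3, d4] <;>
      field_simp <;> ring

theorem det_rightTurn (x z z' : K) : (rightTurn x z z').det = x * z * z' := by
  simp [rightTurn, Matrix.det_fin_three]; ring

theorem det_leftTurn (x z z' : K) : (leftTurn x z z').det = x * z * z' := by
  simp only [leftTurn, Matrix.det_fin_three, Matrix.of_apply, Matrix.cons_val]; ring

end Flags

/-! ### Laurent polynomials with natural coefficients -/

/-- Laurent polynomials with natural numbers as coefficients. -/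
abbrev NatLaurent (ι : Type) : Type := AddMonoidAlgebra ℕ (ι →₀ ℤ)

theorem monomialEval_zero {ι : Type} {K : Type u} [Field K] (x : ι → K) :
    monomialEval 0 x = 1 := Finsupp.prod_zero_index

theorem monomialEval_add {ι : Type} {K : Type u} [Field K] {x : ι → K} (hx : ∀ i, x i ≠ 0)
    (m m' : ι →₀ ℤ) : monomialEval (m + m') x = monomialEval m x * monomialEval m' x :=
  Finsupp.prod_add_index' (fun i => zpow_zero (x i)) fun i => zpow_add₀ (hx i)

theorem monomialEval_single {ι : Type} {K : Type u} [Field K] (x : ι → K) (i : ι) (k : ℤ) :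
    monomialEval (Finsupp.single i k) x = x i ^ k :=
  Finsupp.prod_single_index (zpow_zero (x i))

theorem monomialEval_ne_zero {ι : Type} {K : Type u} [Field K] {x : ι → K} (hx : ∀ i, x i ≠ 0)
    (m : ι →₀ ℤ) : monomialEval m x ≠ 0 :=
  Finset.prod_ne_zero_iff.2 fun i _ => zpow_ne_zero _ (hx i)

namespace NatLaurent

variable {ι : Type}

/-- Evaluation at a point with non-zero coordinates. -/
def evalHom {K : Type u} [Field K] {x : ι → K} (hx : ∀ i, x i ≠ 0) : NatLaurent ι →+* K :=
  (AddMonoidAlgebra.lift ℕ K (ι →₀ ℤ)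
    { toFun := fun m => monomialEval m.toAdd x
      map_one' := monomialEval_zero x
      map_mul' := fun m m' => monomialEval_add hx m.toAdd m'.toAdd }).toRingHom

theorem evalHom_apply {K : Type u} [Field K] {x : ι → K} (hx : ∀ i, x i ≠ 0)
    (P : NatLaurent ι) : evalHom hx P = P.coeff.sum fun m k => (k : K) * monomialEval m x := by
  simp only [evalHom, AlgHom.toRingHom_eq_coe, RingHom.coe_coe, AddMonoidAlgebra.lift_apply,
    nsmul_eq_mul]
  rfl

theorem evalHom_single {K : Type u} [Field K] {x : ι → K} (hx : ∀ i, x i ≠ 0) (m : ι →₀ ℤ) :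
    evalHom hx (AddMonoidAlgebra.single m 1) = monomialEval m x := by
  rw [evalHom_apply, AddMonoidAlgebra.coeff_single, Finsupp.sum_single_index (by simp)]
  simp

/-- The sum of the coefficients. -/
def coeffSum : NatLaurent ι →+* ℕ := (AddMonoidAlgebra.lift ℕ ℕ (ι →₀ ℤ) 1).toRingHom

theorem coeffSum_single (m : ι →₀ ℤ) : coeffSum (AddMonoidAlgebra.single m 1) = 1 := by
  simp [coeffSum]

/-- The Laurent polynomial with integer coefficients. -/
def toLaurent (P : NatLaurent ι) : Laurent ι :=
  AddMonoidAlgebra.map (Nat.castAddMonoidHom ℤ) P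

theorem coeff_toLaurent (P : NatLaurent ι) (m : ι →₀ ℤ) : P.toLaurent.coeff m = P.coeff m := rfl

/-- A natural coefficient that does not vanish is positive. -/
theorem isPositiveIntegral_toLaurent (P : NatLaurent ι) : P.toLaurent.IsPositiveIntegral := by
  intro m hm
  rw [Finsupp.mem_support_iff, coeff_toLaurent] at hm
  rw [coeff_toLaurent]
  omega

theorem toLaurent_ne_zero {P : NatLaurent ι} (h : coeffSum P ≠ 0) : P.toLaurent ≠ 0 := by
  intro h0
  apply h
  have : P = 0 := by
    ext m
    have := coeff_toLaurent P m
    rw [h0] at this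
    simpa using this.symm
  rw [this, map_zero]

theorem eval_toLaurent {K : Type u} [Field K] {x : ι → K} (hx : ∀ i, x i ≠ 0)
    (P : NatLaurent ι) : P.toLaurent.eval x = evalHom hx P := by
  rw [evalHom_apply, Laurent.eval, toLaurent, AddMonoidAlgebra.coeff_map,
    Finsupp.sum_mapRange_index (by simp)]
  simp

end NatLaurent

/-! ### Frames of a framed local system -/

namespace FramedLocalSystem

open IdealTriangulation

variable {Γ : Subgroup SL(2, ℤ)} {K : Type u} [Field K]

/-- The lift `g` is prescribed, so that the frames can be compared with a chosen representative of
the monodromy. The line scalars exist because two functionals with the same kernel are proportional.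
-/
theorem exists_scalars_of_mk (L : FramedLocalSystem Γ K) {γ : Γ} {g : GL (Fin 3) K}
    (hg : Matrix.ProjGenLinGroup.mk g = L.ρ γ) :
    ∃ (s t : Cusp → K), (∀ c, s c ≠ 0) ∧ (∀ c, t c ≠ 0) ∧
      (∀ c, (L.β (deck γ c)).pt.rep = s c • (g.1.mulVec (L.β c).pt.rep)) ∧
      (∀ c v, (L.β (deck γ c)).ln.rep ⬝ᵥ (g.1.mulVec v) = t c * ((L.β c).ln.rep ⬝ᵥ v)) := by
  have hpt : ∀ c, ∃ s : K, s ≠ 0 ∧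
      (L.β (deck γ c)).pt.rep = s • (g.1.mulVec (L.β c).pt.rep) := by
    intro c
    have hne : g • (L.β c).pt.rep ≠ 0 := (smul_ne_zero_iff_ne g).2 (L.β c).pt.rep_nonzero
    have h : (L.β (deck γ c)).pt = Projectivization.mk K (g • (L.β c).pt.rep) hne := by
      rw [L.pt_deck γ c, ← hg]
      conv_lhs => rw [← (L.β c).pt.mk_rep]
      exact Projectivization.PGL.mk_smul_mk g _
    obtain ⟨a, ha⟩ := Projectivization.exists_smul_eq_mk_rep K _ hne
    exact ⟨a, a.ne_zero, by rw [h, ← ha]; rfl⟩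
  have hln : ∀ c, ∃ t : K, t ≠ 0 ∧
      ∀ v, (L.β (deck γ c)).ln.rep ⬝ᵥ (g.1.mulVec v) = t * ((L.β c).ln.rep ⬝ᵥ v) := by
    intro c
    have key : ∀ v : Fin 3 → K,
        (L.β (deck γ c)).ln.rep ⬝ᵥ (g.1.mulVec v) = 0 ↔ (L.β c).ln.rep ⬝ᵥ v = 0 := by
      intro v
      by_cases hv : v = 0
      · simp [hv]
      have hne : g • v ≠ 0 := (smul_ne_zero_iff_ne g).2 hv
      have h := L.ln_deck γ c (Projectivization.mk K v hv)
      rw [← hg, Projectivization.PGL.mk_smul_mk g hv, ← (L.β (deck γ c)).ln.mk_rep,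
        ← (L.β c).ln.mk_rep, Projectivization.orthogonal_mk, Projectivization.orthogonal_mk] at h
      rw [dotProduct_comm, dotProduct_comm _ v]
      exact h
    obtain ⟨w, hw⟩ : ∃ w, (L.β c).ln.rep ⬝ᵥ w ≠ 0 := by
      by_contra! hcon
      exact (L.β c).ln.rep_nonzero (dotProduct_eq_zero_iff.1 hcon)
    refine ⟨((L.β (deck γ c)).ln.rep ⬝ᵥ (g.1.mulVec w)) / ((L.β c).ln.rep ⬝ᵥ w),
      div_ne_zero (fun h => hw ((key w).1 h)) hw, fun v => ?_⟩
    have h := (key (v - (((L.β c).ln.rep ⬝ᵥ v) / ((L.β c).ln.rep ⬝ᵥ w)) • w)).2 (by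
      rw [dotProduct_sub, dotProduct_smul, smul_eq_mul, div_mul_cancel₀ _ hw, sub_self])
    rw [Matrix.mulVec_sub, Matrix.mulVec_smul, dotProduct_sub, dotProduct_smul, smul_eq_mul,
      sub_eq_zero] at h
    rw [h]
    ring
  choose s hs hs' using hpt
  choose t ht ht' using hln
  exact ⟨s, t, hs, ht, hs', ht'⟩

variable {L : FramedLocalSystem Γ K} {T : IdealTriangulation Γ}

theorem InChart.generic (h : L.InChart T) {a b c : Cusp} (ht : T.IsTriangle a b c) :
    Generic (L.β a) (L.β b) (L.β c) where
  fg := (h _ _ _ ht).1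
  gf := (h _ _ _ ht).2.1
  gh := (h _ _ _ ht.rotate).1
  hg := (h _ _ _ ht.rotate).2.1
  hf := (h _ _ _ ht.rotate.rotate).1
  fh := (h _ _ _ ht.rotate.rotate).2.1
  det := (h _ _ _ ht).2.2

theorem InChart.coord_ne_zero (h : L.InChart T) (i : T.MarkedPoint) : L.coord T i ≠ 0 := by
  induction i using Quot.ind with
  | mk x =>
    change L.liftedCoord T x ≠ 0
    cases x with
    | face a b c ht =>
      have hg := h.generic ht
      exact div_ne_zero (mul_ne_zero (mul_ne_zero hg.fg hg.gh) hg.hf)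
        (mul_ne_zero (mul_ne_zero hg.fh hg.gf) hg.hg)
    | edge a b c d h₁ h₂ =>
      have hg := h.generic h₁
      have hg' := h.generic h₂
      exact div_ne_zero (mul_ne_zero hg.fg hg'.det) (mul_ne_zero hg'.fh hg.det)

theorem traceCube_pow {γ : Γ} {M : GL (Fin 3) K} (hM : Matrix.ProjGenLinGroup.mk M = L.ρ γ)
    (n : ℕ) : traceCube (L.ρ γ ^ n) = (M.1 ^ n).trace ^ 3 / M.1.det ^ n := by
  rw [← hM, ← map_pow, traceCube_mk, Units.val_pow_eq_pow_val, Matrix.det_pow]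

variable [Γ.FiniteIndex]

/-- The coordinate system on `K³` attached to an oriented edge. -/
def frame (L : FramedLocalSystem Γ K) (e : T.OrientedEdge) : Matrix (Fin 3) (Fin 3) K :=
  flagFrame (L.β e.src) (L.β e.tgt) (L.β e.third)

theorem exists_frame_act_mul (L : FramedLocalSystem Γ K) {γ : Γ} {g : GL (Fin 3) K}
    (hg : Matrix.ProjGenLinGroup.mk g = L.ρ γ) (e : T.OrientedEdge) :
    ∃ μ : K, μ ≠ 0 ∧ L.frame (e.act γ) * g.1 = μ • L.frame e := by
  obtain ⟨s, t, hs, ht, hp, hl⟩ := L.exists_scalars_of_mk hg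
  have hpair : ∀ a b, pairing (L.β (deck γ a)) (L.β (deck γ b)) =
      t a * s b * pairing (L.β a) (L.β b) := by
    intro a b
    simp only [pairing]
    rw [hp b, dotProduct_smul, hl a, smul_eq_mul]
    ring
  have hdet2 : ∀ a b v, det2 (L.β (deck γ a)) (L.β (deck γ b)) (g.1.mulVec v) =
      s a * s b * g.1.det * det2 (L.β a) (L.β b) v := by
    intro a b v
    simp only [det2]
    rw [hp a, hp b]
    simp only [Matrix.det_fin_three, Matrix.mulVec, dotProduct, Fin.sum_univ_three,
      Pi.smul_apply, smul_eq_mul, Matrix.of_apply, Matrix.cons_val_zero, Matrix.cons_val_one,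
      Matrix.cons_val]
    ring
  have hdet3 : ∀ a b c, det3 (L.β (deck γ a)) (L.β (deck γ b)) (L.β (deck γ c)) =
      s a * s b * g.1.det * (s c * det3 (L.β a) (L.β b) (L.β c)) := by
    intro a b c
    have : ∀ v, det2 (L.β a) (L.β b) (s c • v) = s c * det2 (L.β a) (L.β b) v := by
      intro v
      simp only [det2, Matrix.det_fin_three, Pi.smul_apply, smul_eq_mul, Matrix.of_apply,
        Matrix.cons_val_zero, Matrix.cons_val_one, Matrix.cons_val]
      ring
    rw [← det2_pt, hp c, ← Matrix.mulVec_smul, hdet2, this, det2_pt]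
  have hd : g.1.det ≠ 0 := g.det_ne_zero
  -- In every row the scalars of the two end flags and the determinant of `g` cancel; only that of
  -- the normalizing point remains.
  refine ⟨(s e.third)⁻¹, inv_ne_zero (hs _), ?_⟩
  apply Matrix.ext_of_mulVec_single
  intro j
  rw [← Matrix.mulVec_mulVec, Matrix.smul_mulVec, frame, frame, flagFrame_mulVec,
    flagFrame_mulVec, e.third_act]
  dsimp only [OrientedEdge.act]
  rw [hl, hl, hdet2, hdet3, hpair, hpair]
  simp only [Matrix.smul_cons, smul_eq_mul, Matrix.smul_empty]
  congr 1
  · rw [mul_assoc (t _), mul_div_mul_left _ _ (ht _), div_mul_eq_div_div, div_right_comm,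
      div_eq_inv_mul]
  congr 1
  · rw [← mul_neg, mul_div_mul_left _ _ (mul_ne_zero (mul_ne_zero (hs _) (hs _)) hd)]
    rw [div_mul_eq_div_div, div_right_comm, div_eq_inv_mul]
  congr 1
  · rw [mul_assoc (t _), mul_div_mul_left _ _ (ht _), div_mul_eq_div_div, div_right_comm,
      div_eq_inv_mul]

/-- The frames at `e` and `f` differ by the matrix `W` of positive Laurent polynomials in the
canonical coordinates, with the monomial `d` as determinant, and by a scalar. -/
def IsTransition (e f : T.OrientedEdge) (W : Matrix (Fin 3) (Fin 3) (NatLaurent T.MarkedPoint))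
    (d : T.MarkedPoint →₀ ℤ) : Prop :=
  (∀ i, NatLaurent.coeffSum (W i i) ≠ 0) ∧
    ∀ (K : Type u) [Field K] (L : FramedLocalSystem Γ K) (h : L.InChart T),
      (∃ c : K, c ≠ 0 ∧ L.frame f =
        c • ((NatLaurent.evalHom h.coord_ne_zero).mapMatrix W * L.frame e)) ∧
      ((NatLaurent.evalHom h.coord_ne_zero).mapMatrix W).det = monomialEval d (L.coord T)

theorem coeffSum_mul_diag_ne_zero {ι : Type} {V W : Matrix (Fin 3) (Fin 3) (NatLaurent ι)}
    (hV : ∀ i, NatLaurent.coeffSum (V i i) ≠ 0) (hW : ∀ i, NatLaurent.coeffSum (W i i) ≠ 0)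
    (i : Fin 3) : NatLaurent.coeffSum ((V * W) i i) ≠ 0 := by
  rw [Matrix.mul_apply, map_sum]
  intro h
  have := Finset.sum_eq_zero_iff.1 h i (Finset.mem_univ i)
  rw [map_mul, mul_eq_zero] at this
  exact this.elim (hV i) (hW i)

theorem coeffSum_one_diag_ne_zero {ι : Type} (i : Fin 3) :
    NatLaurent.coeffSum ((1 : Matrix (Fin 3) (Fin 3) (NatLaurent ι)) i i) ≠ 0 := by
  rw [Matrix.one_apply_eq, map_one]
  exact one_ne_zero

theorem IsTransition.refl (e : T.OrientedEdge) : IsTransition.{u} e e 1 0 := by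
  refine ⟨coeffSum_one_diag_ne_zero, fun K _ L h => ⟨⟨1, one_ne_zero, ?_⟩, ?_⟩⟩
  · rw [map_one, one_mul, one_smul]
  · rw [map_one, Matrix.det_one, monomialEval_zero]

theorem IsTransition.trans {e f f' : T.OrientedEdge}
    {V W : Matrix (Fin 3) (Fin 3) (NatLaurent T.MarkedPoint)} {d d' : T.MarkedPoint →₀ ℤ}
    (hW : IsTransition.{u} e f W d) (hV : IsTransition.{u} f f' V d') :
    IsTransition.{u} e f' (V * W) (d' + d) := by
  refine ⟨coeffSum_mul_diag_ne_zero hV.1 hW.1, fun K _ L h => ?_⟩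
  obtain ⟨⟨c, hc, h1⟩, h2⟩ := hW.2 K L h
  obtain ⟨⟨c', hc', h3⟩, h4⟩ := hV.2 K L h
  refine ⟨⟨c' * c, mul_ne_zero hc' hc, ?_⟩, ?_⟩
  · rw [h3, h1, map_mul, Matrix.mul_smul, smul_smul, Matrix.mul_assoc]
  · rw [map_mul, Matrix.det_mul, h2, h4, monomialEval_add h.coord_ne_zero]

theorem mapMatrix_rightTurn {R S : Type*} [CommSemiring R] [CommSemiring S] (φ : R →+* S)
    (x z z' : R) : φ.mapMatrix (rightTurn x z z') = rightTurn (φ x) (φ z) (φ z') := by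
  ext i j
  fin_cases i <;> fin_cases j <;> simp [rightTurn]

theorem mapMatrix_leftTurn {R S : Type*} [CommSemiring R] [CommSemiring S] (φ : R →+* S)
    (x z z' : R) : φ.mapMatrix (leftTurn x z z') = leftTurn (φ x) (φ z) (φ z') := by
  ext i j
  fin_cases i <;> fin_cases j <;> simp [leftTurn]

/-- The Laurent monomial `x_i ^ k`. -/
def varPow {ι : Type} (i : ι) (k : ℤ) : NatLaurent ι :=
  AddMonoidAlgebra.single (Finsupp.single i k) 1

theorem evalHom_varPow {ι : Type} {x : ι → K} (hx : ∀ i, x i ≠ 0) (i : ι) (k : ℤ) :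
    NatLaurent.evalHom hx (varPow i k) = x i ^ k := by
  rw [varPow, NatLaurent.evalHom_single, monomialEval_single]

theorem coeffSum_varPow {ι : Type} (i : ι) (k : ℤ) : NatLaurent.coeffSum (varPow i k) = 1 :=
  NatLaurent.coeffSum_single _

theorem exists_isTransition_step_true (e : T.OrientedEdge) :
    ∃ W d, IsTransition.{u} e (e.step true) W d := by
  have ht := e.isTriangle
  have ht' := (e.step true).isTriangle
  rw [e.step_true_src, e.step_true_tgt] at ht'
  let x : T.MarkedPoint := Quot.mk _ (.face _ _ _ ht)
  let z : T.MarkedPoint := Quot.mk _ (.edge _ _ _ _ ht ht')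
  let z' : T.MarkedPoint := Quot.mk _ (.edge _ _ _ _ ht'.rotate ht.rotate.rotate)
  refine ⟨rightTurn (varPow x 1) (varPow z 1) (varPow z' (-1)),
    Finsupp.single x 1 + Finsupp.single z 1 + Finsupp.single z' (-1), ?_, fun K _ L h => ?_⟩
  · intro i
    fin_cases i <;> simp [rightTurn, coeffSum_varPow]
  · rw [mapMatrix_rightTurn]
    simp only [evalHom_varPow, zpow_one, zpow_neg]
    have hf : L.frame (e.step true) =
        flagFrame (L.β e.src) (L.β e.third) (L.β (e.step true).third) := by
      rw [frame, e.step_true_src, e.step_true_tgt]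
    refine ⟨⟨_, ?_, hf.trans (flagFrame_rightTurn (h.generic ht) (h.generic ht'))⟩, ?_⟩
    rotate_left
    · rw [det_rightTurn, monomialEval_add h.coord_ne_zero, monomialEval_add h.coord_ne_zero,
        monomialEval_single, monomialEval_single, monomialEval_single, zpow_one, zpow_one,
        zpow_neg, zpow_one]
    · exact div_ne_zero (mul_ne_zero (h.generic ht).det (h.generic ht).fh)
        (mul_ne_zero (h.generic ht').det (h.generic ht).fg)

theorem exists_isTransition_step_false (e : T.OrientedEdge) :
    ∃ W d, IsTransition.{u} e (e.step false) W d := by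
  have ht := e.isTriangle
  have ht' := (e.step false).isTriangle
  rw [e.step_false_src, e.step_false_tgt] at ht'
  let x : T.MarkedPoint := Quot.mk _ (.face _ _ _ ht)
  let z : T.MarkedPoint := Quot.mk _ (.edge _ _ _ _ ht.rotate.rotate ht')
  let z' : T.MarkedPoint := Quot.mk _ (.edge _ _ _ _ ht'.rotate ht.rotate)
  refine ⟨leftTurn (varPow x (-1)) (varPow z 1) (varPow z' (-1)),
    Finsupp.single x (-1) + Finsupp.single z 1 + Finsupp.single z' (-1), ?_, fun K _ L h => ?_⟩
  · intro i
    fin_cases i <;> simp [leftTurn, coeffSum_varPow]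
  · rw [mapMatrix_leftTurn]
    simp only [evalHom_varPow, zpow_one, zpow_neg]
    have hf : L.frame (e.step false) =
        flagFrame (L.β e.third) (L.β e.tgt) (L.β (e.step false).third) := by
      rw [frame, e.step_false_src, e.step_false_tgt]
    refine ⟨⟨_, ?_, hf.trans (flagFrame_leftTurn (h.generic ht) (h.generic ht'))⟩, ?_⟩
    rotate_left
    · rw [det_leftTurn, monomialEval_add h.coord_ne_zero, monomialEval_add h.coord_ne_zero,
        monomialEval_single, monomialEval_single, monomialEval_single, zpow_one, zpow_neg,
        zpow_neg, zpow_one, zpow_one]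
    · exact div_ne_zero (mul_ne_zero (h.generic ht).det (h.generic ht).gh)
        (mul_ne_zero (h.generic ht').det (h.generic ht).gf)

theorem exists_isTransition_walk (w : List Bool) (e : T.OrientedEdge) :
    ∃ W d, IsTransition.{u} e (e.walk w) W d := by
  induction w generalizing e with
  | nil => exact ⟨1, 0, IsTransition.refl e⟩
  | cons i w ih =>
    obtain ⟨V, d', hV⟩ := ih (e.step i)
    obtain ⟨W, d, hW⟩ : ∃ W d, IsTransition.{u} e (e.step i) W d := by
      cases i
      · exact exists_isTransition_step_false e
      · exact exists_isTransition_step_true e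
    exact ⟨_, _, hW.trans hV⟩

theorem InChart.det_frame_ne_zero (h : L.InChart T) (e : T.OrientedEdge) :
    (L.frame e).det ≠ 0 :=
  det_flagFrame_ne_zero (h.generic e.isTriangle)

/-- The transition matrix from an edge to its translate by `γ⁻¹` represents the monodromy of `γ`,
up to conjugation. -/
theorem exists_representative {γ : Γ} {e : T.OrientedEdge}
    {W : Matrix (Fin 3) (Fin 3) (NatLaurent T.MarkedPoint)} {d : T.MarkedPoint →₀ ℤ}
    (hW : IsTransition.{u} e (e.act γ⁻¹) W d) (h : L.InChart T) :
    ∃ M : GL (Fin 3) K, Matrix.ProjGenLinGroup.mk M = L.ρ γ ∧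
      M.1.det = monomialEval d (L.coord T) ∧
      ∀ n : ℕ, (M.1 ^ n).trace = NatLaurent.evalHom h.coord_ne_zero (W ^ n).trace := by
  obtain ⟨⟨c, hc, h1⟩, h2⟩ := hW.2 K L h
  obtain ⟨g, hg⟩ := Matrix.ProjGenLinGroup.mk_surjective (L.ρ γ⁻¹)
  obtain ⟨μ, hμ, h3⟩ := L.exists_frame_act_mul hg e
  set V := (NatLaurent.evalHom h.coord_ne_zero).mapMatrix W with hV
  have hVdet : V.det ≠ 0 := by rw [h2]; exact monomialEval_ne_zero h.coord_ne_zero d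
  let F := Matrix.GeneralLinearGroup.mkOfDetNeZero (L.frame e) (h.det_frame_ne_zero e)
  let U := Matrix.GeneralLinearGroup.mkOfDetNeZero V hVdet
  have hF : F.1 = L.frame e := rfl
  have hU : U.1 = V := rfl
  have hpow : ∀ n : ℕ, (F⁻¹ * U * F) ^ n = F⁻¹ * U ^ n * F := fun n => by
    have := conj_pow (i := n) (a := F⁻¹) (b := U)
    rwa [inv_inv] at this
  refine ⟨F⁻¹ * U * F, ?_, ?_, fun n => ?_⟩
  -- The translate is by `γ⁻¹` because `c • V * F` is the frame there, and multiplying it by a lift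
  -- `g` of `ρ γ⁻¹` gives back a multiple of `F`. So `F⁻¹ * V * F` is inverse to `g` up to a scalar.
  · have hrel : (F⁻¹ * U * F) * g = Matrix.GeneralLinearGroup.scalar (Fin 3)
        (Units.mk0 (c⁻¹ * μ) (mul_ne_zero (inv_ne_zero hc) hμ)) := by
      have h4 : V * L.frame e * g.1 = (c⁻¹ * μ) • L.frame e := by
        rw [mul_smul, ← h3, h1, Matrix.smul_mul, smul_smul, inv_mul_cancel₀ hc, one_smul]
      have h5 : U * F * g = F * Matrix.GeneralLinearGroup.scalar (Fin 3)
          (Units.mk0 (c⁻¹ * μ) (mul_ne_zero (inv_ne_zero hc) hμ)) := by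
        ext i j
        have := congrFun (congrFun h4 i) j
        rw [← hF, ← hU] at this
        simpa [Matrix.GeneralLinearGroup.scalar, mul_comm] using this
      rw [mul_assoc, mul_assoc, ← mul_assoc U, h5, inv_mul_cancel_left]
    have hmk := congrArg Matrix.ProjGenLinGroup.mk hrel
    rw [map_mul, hg, map_inv, mul_inv_eq_iff_eq_mul] at hmk
    rw [hmk]
    have : Matrix.ProjGenLinGroup.mk (Matrix.GeneralLinearGroup.scalar (Fin 3)
        (Units.mk0 (c⁻¹ * μ) (mul_ne_zero (inv_ne_zero hc) hμ))) = 1 := by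
      rw [← map_one Matrix.ProjGenLinGroup.mk, eq_comm, Matrix.ProjGenLinGroup.mk_eq_mk_iff]
      exact ⟨_, one_mul _⟩
    rw [this, one_mul]
  · rw [← h2, ← hU]
    simp only [Units.val_mul, Matrix.det_mul]
    rw [mul_right_comm, ← Matrix.det_mul, ← Units.val_mul, inv_mul_cancel, Units.val_one,
      Matrix.det_one, one_mul]
  · rw [← Units.val_pow_eq_pow_val, hpow, Units.val_mul, Units.val_mul]
    have := Matrix.trace_units_conj F⁻¹ (U ^ n).1
    rw [inv_inv] at this
    rw [this, Units.val_pow_eq_pow_val, hU, hV, ← map_pow, Matrix.trace, Matrix.trace, map_sum]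
    rfl

end FramedLocalSystem

/-! ### Traces of powers and the conclusion. -/

/-- Sums in `ℕ` cannot cancel, so non-zero diagonals survive products and traces. -/
theorem coeffSum_trace_pow_ne_zero {ι : Type} {W : Matrix (Fin 3) (Fin 3) (NatLaurent ι)}
    (hW : ∀ i, NatLaurent.coeffSum (W i i) ≠ 0) (n : ℕ) :
    NatLaurent.coeffSum (W ^ n).trace ≠ 0 := by
  have key : ∀ i, NatLaurent.coeffSum ((W ^ n) i i) ≠ 0 := by
    induction n with
    | zero => exact FramedLocalSystem.coeffSum_one_diag_ne_zero
    | succ n ih =>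
      rw [pow_succ]
      exact FramedLocalSystem.coeffSum_mul_diag_ne_zero ih hW
  rw [Matrix.trace, map_sum]
  exact fun h => key 0 (Finset.sum_eq_zero_iff.1 h 0 (Finset.mem_univ 0))

theorem monomialEval_neg_nsmul {ι : Type} {K : Type u} [Field K] {x : ι → K}
    (hx : ∀ i, x i ≠ 0) (d : ι →₀ ℤ) (n : ℕ) :
    monomialEval (-(n • d)) x = (monomialEval d x ^ n)⁻¹ := by
  have hpow : monomialEval (n • d) x = monomialEval d x ^ n := by
    induction n with
    | zero => rw [zero_smul, monomialEval_zero, pow_zero]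
    | succ n ih => rw [succ_nsmul, monomialEval_add hx, ih, pow_succ]
  rw [← hpow]
  apply eq_inv_of_mul_eq_one_left
  rw [← monomialEval_add hx, neg_add_cancel, monomialEval_zero]

end FockGoncharov

end

open FockGoncharov FockGoncharov.IdealTriangulation FockGoncharov.FramedLocalSystem in
theorem corollary2p10 (Γ : Subgroup (Matrix.SpecialLinearGroup (Fin 2) ℤ)) [Γ.FiniteIndex]
    (hΓ : ∀ γ ∈ Γ, IsOfFinOrder γ → γ = 1) (γ : Γ) :
    (∀ T : FockGoncharov.IdealTriangulation Γ,
      ∃ (d : T.MarkedPoint →₀ ℤ) (P : ℕ → FockGoncharov.Laurent T.MarkedPoint),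
        (∀ n, (P n).IsPositiveIntegral ∧ P n ≠ 0) ∧
        ∀ (K : Type u) [Field K] (L : FockGoncharov.FramedLocalSystem Γ K), L.InChart T →
          ∃ M : Matrix.GeneralLinearGroup (Fin 3) K,
            Matrix.ProjGenLinGroup.mk M = L.ρ γ ∧
            M.1.det = FockGoncharov.monomialEval d (L.coord T) ∧
            ∀ n : ℕ, (M.1 ^ n).trace = (P n).eval (L.coord T)) ∧
    ∀ n : ℕ, FockGoncharov.IsGoodPositiveLaurent.{u} Γ
      (fun _ _ L => FockGoncharov.traceCube (L.ρ γ ^ n)) := by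
  have key : ∀ T : IdealTriangulation Γ, ∃ (e : T.OrientedEdge) (W : _) (d : _),
      IsTransition.{u} e (e.act γ⁻¹) W d := by
    intro T
    obtain ⟨e, w, hw⟩ := OrientedEdge.exists_walk_eq_act (T := T) hΓ γ⁻¹
    obtain ⟨W, d, h⟩ := exists_isTransition_walk.{u} w e
    exact ⟨e, W, d, hw ▸ h⟩
  constructor
  · intro T
    obtain ⟨e, W, d, hW⟩ := key T
    refine ⟨d, fun n => NatLaurent.toLaurent (W ^ n).trace, fun n =>
      ⟨NatLaurent.isPositiveIntegral_toLaurent _,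
        NatLaurent.toLaurent_ne_zero (coeffSum_trace_pow_ne_zero hW.1 n)⟩, fun K _ L h => ?_⟩
    obtain ⟨M, h1, h2, h3⟩ := exists_representative hW h
    exact ⟨M, h1, h2, fun n => (h3 n).trans (NatLaurent.eval_toLaurent h.coord_ne_zero _).symm⟩
  · intro n T
    obtain ⟨e, W, d, hW⟩ := key T
    -- The monomial with exponent `-(n • d)` is the inverse of the determinant of the `n`-th power.
    refine ⟨NatLaurent.toLaurent ((W ^ n).trace ^ 3 * AddMonoidAlgebra.single (-(n • d)) 1),
      NatLaurent.isPositiveIntegral_toLaurent _, fun K _ L h => ?_⟩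
    obtain ⟨M, h1, h2, h3⟩ := exists_representative hW h
    dsimp only
    rw [NatLaurent.eval_toLaurent h.coord_ne_zero, map_mul, map_pow, ← h3,
      NatLaurent.evalHom_single, monomialEval_neg_nsmul h.coord_ne_zero, ← h2, traceCube_pow h1,
      div_eq_mul_inv]
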